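/- Let $k$ be a field of characteristic zero and $k[\mathbf x]=k[x_1,x_2,x_3]$. For $f\in k[\mathbf x]\setminus\{0\}$ let $\deg f$ be the total degree ($\deg 0=-\infty$) and $\bar f$ the homogeneous component of $f$ of degree $\deg f$ (that is, $\deg$ and the leading form for the weight $\mathbf w=(1,1,1)$). For a differential form $\omega=\sum_{i_1<\cdots<i_r}f_{i_1\ldots i_r}\,dx_{i_1}\wedge\cdots\wedge dx_{i_r}$ let $\deg\omega=\max\deg(f_{i_1\ldots i_r}x_{i_1}\cdots x_{i_r})$. Write $h_1\approx h_2$ if $h_1,h_2$ are linearly dependent over $k$. Identify a $k$-automorphism $F$ of $k[\mathbf x]$ with the triple $(f_1,f_2,f_3)=(F(x_1),F(x_2),F(x_3))$, and put $\deg F=\deg f_1+\deg f_2+\deg f_3$. $F$ *admits an elementary reduction* if $\deg (F\circ E)<\deg F$ for some elementary automorphism $E$, i.e. one with $E(x_l)=x_l+\phi$ for some $l$ and some polynomial $\phi$ in the two other variables, and $E(x_i)=x_i$ for $i\ne l$. For automorphisms $F=(f_1,f_2,f_3)$ and $G=(g_1,g_2,g_3)$, the pair $(F,G)$ *satisfies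 the Shestakov–Umirbaev condition* if: - (SU1) $g_1=f_1+af_3^2+cf_3$ and $g_2=f_2+bf_3$ for some $a,b,c\in k$, and $g_3-f_3\in k[g_1,g_2]$; - (SU2) $\deg f_1\le\deg g_1$ and $\deg f_2=\deg g_2$; - (SU3) $\bar g_1^{\,2}\approx\bar g_2^{\,s}$ for some odd $s\ge3$; - (SU4) $\deg f_3\le\deg g_1$ and $\bar f_3\notin k[\bar g_1,\bar g_2]$; - (SU5) $\deg g_3<\deg f_3$; - (SU6) $\deg g_3<\deg g_1-\deg g_2+\deg(dg_1\wedge dg_2)$. Reductions of types I, II and III are defined as follows; here $l$ denotes a positive integer. **Type I.** $(f_1,f_2,f_3)$ satisfies (1) if, for some $l$ and some odd $s\ge3$: $\deg f_1=2l$, $\deg f_2=sl$, $2l<\deg f_3\le sl$, $\bar f_3\notin k[\bar f_1,\bar f_2]$, and there is $\alpha\in k\setminus\{0\}$ such that $g_1:=f_1$, $g_2:=f_2-\alpha f_3$ satisfy: $\deg g_2=sl$; $\bar g_1,\bar g_2$ are algebraically dependent over $k$; and for some $\phi\in k[g_1,g_2]$, $g_3:=f_3+\phi$ satisfies $\deg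 g_3<\deg f_3$ and $\deg(dg_1\wedge dg_3)<sl+\deg(dg_1\wedge dg_2)$. **Type II.** $(f_1,f_2,f_3)$ satisfies (2) if, for some $l$: $\deg f_1=2l$, $\deg f_2=3l$, $\tfrac32l<\deg f_3\le2l$, $\bar f_1\not\approx\bar f_3$, and there are $\alpha,\beta\in k$ with $(\alpha,\beta)\ne(0,0)$ such that $g_1:=f_1-\alpha f_3$, $g_2:=f_2-\beta f_3$ satisfy: $\deg g_1=2l$, $\deg g_2=3l$; $\bar g_1,\bar g_2$ are algebraically dependent over $k$; and for some $\phi\in k[g_1,g_2]$, $g_3:=f_3+\phi$ satisfies $\deg g_3<\deg f_3$ and $\deg(dg_1\wedge dg_3)<3l+\deg(dg_1\wedge dg_2)$. **Type III.** $(f_1,f_2,f_3)$ satisfies (3) if, for some $l$: $\deg f_1=2l$; either $\deg f_2=3l$ and $l<\deg f_3\le\tfrac32l$, or $\tfrac52l<\deg f_2\le3l$ and $\deg f_3=\tfrac32l$; and there are $\alpha,\beta,\gamma\in k$ with $(\alpha,\beta,\gamma)\ne(0,0,0)$ such that $g_1:=f_1-\beta f_3$, $g_2:=f_2-\gamma f_3-\alpha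 f_3^2$ satisfy: $\deg g_1=2l$, $\deg g_2=3l$; $\bar g_1,\bar g_2$ are algebraically dependent over $k$; and for some $\sigma\in k\setminus\{0\}$ and $g\in k[g_1,g_2]\setminus k$, $g_3:=\sigma f_3+g$ satisfies $\deg g_3\le\tfrac32l$, $\deg(dg_1\wedge dg_3)<3l+\deg(dg_1\wedge dg_2)$ and $\deg g_3<l+\deg(dg_1\wedge dg_2)$. $F$ *admits a reduction of type* I (resp. II, III) if $(f_{\tau(1)},f_{\tau(2)},f_{\tau(3)})$ satisfies (1) (resp. (2), (3)) for some permutation $\tau$ of $\{1,2,3\}$. **Proposition.** Let $F=(f_1,f_2,f_3)$ and $G=(g_1,g_2,g_3)$ be $k$-automorphisms of $k[\mathbf x]$ such that $(F,G)$ satisfies the Shestakov–Umirbaev condition. If $(f_1,f_2)=(g_1,g_2)$, then $F$ admits an elementary reduction. If $(f_1,f_2)\ne(g_1,g_2)$, then $F$ admits a reduction of one of the types I, II and III. -/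

import Mathlib

open scoped KaehlerDifferential ExteriorAlgebra

namespace SURed

noncomputable section

section Degree

variable {k : Type*} [Field k] {n : ℕ}

/-- The total degree of a polynomial (the weighted degree for the weight `(1, …, 1)`),
with value `⊥` (that is, `-∞`) exactly at `0`. -/
def deg (f : MvPolynomial (Fin n) k) : WithBot ℕ :=
  MvPolynomial.weightedTotalDegree' (fun _ => (1 : ℕ)) f

theorem deg_zero : deg (0 : MvPolynomial (Fin n) k) = ⊥ :=
  MvPolynomial.weightedTotalDegree'_zero _

theorem deg_eq_totalDegree {f : MvPolynomial (Fin n) k} (hf : f ≠ 0) :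
    deg f = (f.totalDegree : WithBot ℕ) := by
  have h := MvPolynomial.weightedTotalDegree_coe (fun _ : Fin n => (1 : ℕ)) f hf
  have h1 := MvPolynomial.weightedTotalDegree_one f
  exact h.trans (congrArg _ h1)

/-- The leading form `f^w` of `f`: its homogeneous component of degree `deg f`
(equal to `0` for `f = 0`). -/
def lead (f : MvPolynomial (Fin n) k) : MvPolynomial (Fin n) k :=
  MvPolynomial.homogeneousComponent f.totalDegree f

/-- The degree of a differential `l`-form `ω = ∑_s f_s dx_{s_1} ∧ ⋯ ∧ dx_{s_l}` over the
`l`-element subsets `s` of the set of variables: the maximum of the degrees of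
`f_s * ∏_{i ∈ s} x_i`, which is `⊥` for `ω = 0`. -/
def formDeg {l : ℕ}
    (ω : ⋀[MvPolynomial (Fin n) k]^l (Ω[MvPolynomial (Fin n) k⁄k])) : WithBot ℕ :=
  Finset.univ.sup fun s : Set.powersetCard (Fin n) l =>
    deg ((((KaehlerDifferential.mvPolynomialBasis k (Fin n)).exteriorPower l).repr ω s) *
      ∏ i ∈ (s : Finset (Fin n)), MvPolynomial.X i)

/-- The 2-form `df ∧ dg`. -/
def dwedge (f g : MvPolynomial (Fin n) k) :
    ⋀[MvPolynomial (Fin n) k]^2 (Ω[MvPolynomial (Fin n) k⁄k]) :=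
  exteriorPower.ιMulti (MvPolynomial (Fin n) k) 2
    ![KaehlerDifferential.D k (MvPolynomial (Fin n) k) f,
      KaehlerDifferential.D k (MvPolynomial (Fin n) k) g]

/-- `h₁ ≈ h₂`: the polynomials are linearly dependent over `k`. -/
def LinDep (h₁ h₂ : MvPolynomial (Fin n) k) : Prop :=
  ¬ LinearIndependent k ![h₁, h₂]

end Degree

section Reductions

variable {k : Type*} [Field k]

/-- The Shestakov–Umirbaev condition for a pair of triples `(f₁, f₂, f₃)`, `(g₁, g₂, g₃)` and the
weight `(1, 1, 1)`. The indices `1, 2, 3` of the mathematics are `0, 1, 2` here. -/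
structure SUCondition (f g : Fin 3 → MvPolynomial (Fin 3) k) : Prop where
  su1 : (∃ a b c : k, g 0 = f 0 + a • (f 2) ^ 2 + c • f 2 ∧ g 1 = f 1 + b • f 2) ∧
    g 2 - f 2 ∈ Algebra.adjoin k {g 0, g 1}
  su2 : deg (f 0) ≤ deg (g 0) ∧ deg (f 1) = deg (g 1)
  su3 : ∃ s : ℕ, Odd s ∧ 3 ≤ s ∧ LinDep (lead (g 0) ^ 2) (lead (g 1) ^ s)
  su4 : deg (f 2) ≤ deg (g 0) ∧ lead (f 2) ∉ Algebra.adjoin k {lead (g 0), lead (g 1)}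
  su5 : deg (g 2) < deg (f 2)
  /-- `deg g₃ < deg g₁ - deg g₂ + deg (dg₁ ∧ dg₂)`, written without subtraction. -/
  su6 : deg (g 2) + deg (g 1) < deg (g 0) + formDeg (dwedge (g 0) (g 1))

/-- Automorphisms of the `k`-algebra `k[x₁, x₂, x₃]`. -/
abbrev Aut3 (k : Type*) [Field k] : Type _ :=
  MvPolynomial (Fin 3) k ≃ₐ[k] MvPolynomial (Fin 3) k

/-- The triple `(F(x₁), F(x₂), F(x₃))` with which `F` is identified. -/
def triple (F : Aut3 k) : Fin 3 → MvPolynomial (Fin 3) k := fun i => F (MvPolynomial.X i)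

/-- `deg F = deg f₁ + deg f₂ + deg f₃`. -/
def autDeg (F : Aut3 k) : WithBot ℕ := ∑ i, deg (triple F i)

/-- `E` is elementary: for some `l`, `E(x_l) = x_l + φ` with `φ` a polynomial in the other
variables, and `E` fixes the other variables. -/
def IsElementary (E : Aut3 k) : Prop :=
  ∃ l : Fin 3, (∃ φ ∈ MvPolynomial.supported k ({l}ᶜ : Set (Fin 3)),
      E (MvPolynomial.X l) = MvPolynomial.X l + φ) ∧
    ∀ i, i ≠ l → E (MvPolynomial.X i) = MvPolynomial.X i

/-- `F` admits an elementary reduction: `deg (F ∘ E) < deg F` for some elementary `E`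
(`E.trans F` is the composite `F ∘ E`). -/
def AdmitsElementaryReduction (F : Aut3 k) : Prop :=
  ∃ E : Aut3 k, IsElementary E ∧ autDeg (E.trans F) < autDeg F

/-- The condition for a reduction of type I, on the triple `(f₁, f₂, f₃)` in the given order. -/
def TypeI (f : Fin 3 → MvPolynomial (Fin 3) k) : Prop :=
  ∃ l s : ℕ, 0 < l ∧ Odd s ∧ 3 ≤ s ∧
    deg (f 0) = ((2 * l : ℕ) : WithBot ℕ) ∧ deg (f 1) = ((s * l : ℕ) : WithBot ℕ) ∧
    ((2 * l : ℕ) : WithBot ℕ) < deg (f 2) ∧ deg (f 2) ≤ ((s * l : ℕ) : WithBot ℕ) ∧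
    lead (f 2) ∉ Algebra.adjoin k {lead (f 0), lead (f 1)} ∧
    ∃ α : k, α ≠ 0 ∧ ∃ g₁ g₂ : MvPolynomial (Fin 3) k,
      g₁ = f 0 ∧ g₂ = f 1 - α • f 2 ∧
      deg g₂ = ((s * l : ℕ) : WithBot ℕ) ∧
      ¬ AlgebraicIndependent k ![lead g₁, lead g₂] ∧
      ∃ φ ∈ Algebra.adjoin k {g₁, g₂}, ∃ g₃ : MvPolynomial (Fin 3) k,
        g₃ = f 2 + φ ∧ deg g₃ < deg (f 2) ∧
        formDeg (dwedge g₁ g₃) < ((s * l : ℕ) : WithBot ℕ) + formDeg (dwedge g₁ g₂)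

/-- The condition for a reduction of type II, on the triple `(f₁, f₂, f₃)` in the given order. The
bound `(3/2) l < deg f₃` is written `3 l < 2 deg f₃`. -/
def TypeII (f : Fin 3 → MvPolynomial (Fin 3) k) : Prop :=
  ∃ l : ℕ, 0 < l ∧
    deg (f 0) = ((2 * l : ℕ) : WithBot ℕ) ∧ deg (f 1) = ((3 * l : ℕ) : WithBot ℕ) ∧
    ((3 * l : ℕ) : WithBot ℕ) < 2 • deg (f 2) ∧ deg (f 2) ≤ ((2 * l : ℕ) : WithBot ℕ) ∧
    ¬ LinDep (lead (f 0)) (lead (f 2)) ∧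
    ∃ α β : k, (α, β) ≠ (0, 0) ∧ ∃ g₁ g₂ : MvPolynomial (Fin 3) k,
      g₁ = f 0 - α • f 2 ∧ g₂ = f 1 - β • f 2 ∧
      deg g₁ = ((2 * l : ℕ) : WithBot ℕ) ∧ deg g₂ = ((3 * l : ℕ) : WithBot ℕ) ∧
      ¬ AlgebraicIndependent k ![lead g₁, lead g₂] ∧
      ∃ φ ∈ Algebra.adjoin k {g₁, g₂}, ∃ g₃ : MvPolynomial (Fin 3) k,
        g₃ = f 2 + φ ∧ deg g₃ < deg (f 2) ∧
        formDeg (dwedge g₁ g₃) < ((3 * l : ℕ) : WithBot ℕ) + formDeg (dwedge g₁ g₂)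

/-- The condition for a reduction of type III, on the triple `(f₁, f₂, f₃)` in the given order.
Bounds by half-integral multiples of `l` are multiplied by `2`. -/
def TypeIII (f : Fin 3 → MvPolynomial (Fin 3) k) : Prop :=
  ∃ l : ℕ, 0 < l ∧
    deg (f 0) = ((2 * l : ℕ) : WithBot ℕ) ∧
    ((deg (f 1) = ((3 * l : ℕ) : WithBot ℕ) ∧
        (l : WithBot ℕ) < deg (f 2) ∧ 2 • deg (f 2) ≤ ((3 * l : ℕ) : WithBot ℕ)) ∨
      (((5 * l : ℕ) : WithBot ℕ) < 2 • deg (f 1) ∧ deg (f 1) ≤ ((3 * l : ℕ) : WithBot ℕ) ∧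
        2 • deg (f 2) = ((3 * l : ℕ) : WithBot ℕ))) ∧
    ∃ α β γ : k, (α, β, γ) ≠ (0, 0, 0) ∧ ∃ g₁ g₂ : MvPolynomial (Fin 3) k,
      g₁ = f 0 - β • f 2 ∧ g₂ = f 1 - γ • f 2 - α • (f 2) ^ 2 ∧
      deg g₁ = ((2 * l : ℕ) : WithBot ℕ) ∧ deg g₂ = ((3 * l : ℕ) : WithBot ℕ) ∧
      ¬ AlgebraicIndependent k ![lead g₁, lead g₂] ∧
      ∃ σ : k, σ ≠ 0 ∧ ∃ g ∈ Algebra.adjoin k {g₁, g₂},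
        g ∉ Set.range (MvPolynomial.C : k → MvPolynomial (Fin 3) k) ∧
        ∃ g₃ : MvPolynomial (Fin 3) k,
          g₃ = σ • f 2 + g ∧ 2 • deg g₃ ≤ ((3 * l : ℕ) : WithBot ℕ) ∧
          formDeg (dwedge g₁ g₃) < ((3 * l : ℕ) : WithBot ℕ) + formDeg (dwedge g₁ g₂) ∧
          deg g₃ < (l : WithBot ℕ) + formDeg (dwedge g₁ g₂)

/-- `F` admits a reduction of type I: some permutation of its triple satisfies the condition. -/
def AdmitsTypeI (F : Aut3 k) : Prop := ∃ τ : Equiv.Perm (Fin 3), TypeI (triple F ∘ τ)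

/-- `F` admits a reduction of type II: some permutation of its triple satisfies the condition. -/
def AdmitsTypeII (F : Aut3 k) : Prop := ∃ τ : Equiv.Perm (Fin 3), TypeII (triple F ∘ τ)

/-- `F` admits a reduction of type III: some permutation of its triple satisfies the condition. -/
def AdmitsTypeIII (F : Aut3 k) : Prop := ∃ τ : Equiv.Perm (Fin 3), TypeIII (triple F ∘ τ)

end Reductions

end

end SURed

/-!
Write `deg g₂ = 2δ` and `deg g₁ = sδ` with `s` odd, as forced by `su3`, and let
`N = deg (dg₁ ∧ dg₂)`. The heart of the matter is a lower bound for the degree of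
`φ = g₃ - f₃ = Ψ(g₁, g₂)`, whose leading form is that of `-f₃` and hence lies outside the algebra
generated by the leading forms `u, v` of `g₁, g₂`.

*The inequality* (`exists_shestakov_umirbaev`). Give the variables of `Ψ` the weights `sδ, 2δ`, let
`D` be the weighted degree of `Ψ` and `H` its top form, and let `r` be the multiplicity of `u` as a
root of the univariate polynomial `H(T, v)`. The identity `dg₂ ∧ dφ = (∂₁Ψ)(g₁, g₂) dg₂ ∧ dg₁` shows
that `deg φ ≥ deg (∂₁Ψ)(g₁, g₂) + N - 2δ`, and each differentiation lowers `r` by one. When `r = 0`,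
the top form does not vanish at `(u, v)` and nothing cancels. This gives
`deg φ ≥ D + r (N - sδ - 2δ)` (`HasWTop.le_deg_aeval`). As `s` is odd, `H(T, v)` is even or odd in
`T`, so `-u` is a root of the same multiplicity and `D ≥ 2rsδ`
(`HasWTop.two_mul_rootMultiplicity_le`). Since the leading form of `φ` is not in `k[u, v]`, we have
`r ≥ 1`, and `deg f₃ = deg φ ≥ (s - 2)δ + N` follows (`SUData.add_le`).

*The cases.* If `(f₁, f₂) = (g₁, g₂)`, adding `φ` to the third coordinate is an elementary
reduction.
Otherwise the triple `(f₂, f₁, f₃)` is of type I, II or III according as `deg f₃ > 2δ`,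
`2δ ≥ deg f₃ > 3δ/2` or `3δ/2 ≥ deg f₃`; in the last two cases the inequality forces `s = 3`. The
condition on `dg₂ ∧ dg₃` follows from `su6`, and the remaining conditions compare leading forms. Only
one of them is not immediate: in type III, if `deg f₁ < deg g₁`, then `deg f₁ > 5δ/2`
(`SUData.five_mul_lt`). There `r = 1`, so Euler's identity shows that `∂₂H` does not vanish at
`(u, v)` either, and the degree of `dg₁ ∧ df₃ = df₁ ∧ df₃` can be computed.
-/

/-! ### Degrees and leading forms -/

namespace SURed

open MvPolynomial

theorem add_lt_coe_of_lt_of_le {x y : WithBot ℕ} {d e : ℕ} (hx : x < (d : WithBot ℕ))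
    (hy : y ≤ (e : WithBot ℕ)) : x + y < ((d + e : ℕ) : WithBot ℕ) := by
  induction x with
  | bot => rw [WithBot.bot_add]; exact WithBot.bot_lt_coe _
  | coe x =>
    induction y with
    | bot => rw [WithBot.add_bot]; exact WithBot.bot_lt_coe _
    | coe y =>
      have hx' : x < d := WithBot.coe_lt_coe.1 hx
      have hy' : y ≤ e := WithBot.coe_le_coe.1 hy
      exact WithBot.coe_lt_coe.2 (Nat.add_lt_add_of_lt_of_le hx' hy')

section DegreeArithmetic

variable {k : Type*} [Field k] {n : ℕ} {f g f₀ g₀ : MvPolynomial (Fin n) k} {d e : ℕ}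

theorem deg_eq_bot : deg f = ⊥ ↔ f = 0 :=
  weightedTotalDegree'_eq_bot_iff _ _

theorem ne_zero_of_deg_eq (h : deg f = (d : WithBot ℕ)) : f ≠ 0 := by
  rintro rfl
  simp [deg_zero] at h

theorem deg_mul (f g : MvPolynomial (Fin n) k) : deg (f * g) = deg f + deg g := by
  by_cases hf : f = 0
  · simp [hf, deg_zero]
  by_cases hg : g = 0
  · simp [hg, deg_zero]
  rw [deg_eq_totalDegree hf, deg_eq_totalDegree hg, deg_eq_totalDegree (mul_ne_zero hf hg),
    totalDegree_mul_of_isDomain hf hg]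
  rfl

theorem deg_add_le (f g : MvPolynomial (Fin n) k) : deg (f + g) ≤ max (deg f) (deg g) := by
  classical
  refine (Finset.sup_mono support_add).trans ?_
  rw [Finset.sup_union]
  rfl

theorem deg_C (c : k) (hc : c ≠ 0) : deg (C c : MvPolynomial (Fin n) k) = 0 := by
  rw [deg_eq_totalDegree (by simpa using hc), totalDegree_C]
  rfl

theorem deg_smul_le (c : k) (f : MvPolynomial (Fin n) k) : deg (c • f) ≤ deg f := by
  by_cases hc : c = 0
  · simp [hc, deg_zero]
  · rw [smul_eq_C_mul, deg_mul, deg_C c hc, zero_add]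

theorem deg_neg (f : MvPolynomial (Fin n) k) : deg (-f) = deg f := by
  have h : ∀ f : MvPolynomial (Fin n) k, deg (-f) ≤ deg f := fun f => by
    simpa using deg_smul_le (-1) f
  exact le_antisymm (h f) (by simpa using h (-f))

theorem deg_sub_le (f g : MvPolynomial (Fin n) k) : deg (f - g) ≤ max (deg f) (deg g) := by
  rw [sub_eq_add_neg, ← deg_neg g]
  exact deg_add_le _ _

theorem deg_le_coe_iff : deg f ≤ (d : WithBot ℕ) ↔ f.totalDegree ≤ d := by
  by_cases hf : f = 0
  · simp [hf, deg_zero]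
  · rw [deg_eq_totalDegree hf, Nat.cast_le]

theorem deg_le_of_isHomogeneous (h : f.IsHomogeneous d) : deg f ≤ (d : WithBot ℕ) :=
  deg_le_coe_iff.2 h.totalDegree_le

theorem deg_eq_of_isHomogeneous (h : f.IsHomogeneous d) (hf : f ≠ 0) :
    deg f = (d : WithBot ℕ) := by
  rw [deg_eq_totalDegree hf, h.totalDegree hf]

/-- `X_i ∂_i f` has degree at most `deg f`. -/
theorem deg_X_mul_pderiv_le (i : Fin n) (f : MvPolynomial (Fin n) k) :
    deg (X i * pderiv i f) ≤ deg f := by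
  refine Finset.sup_mono fun m hm => ?_
  rw [mem_support_iff] at hm ⊢
  contrapose! hm
  rw [coeff_X_mul']
  split_ifs with h
  · have hi : m i ≠ 0 := by simpa using h
    rw [coeff_pderiv, tsub_add_cancel_of_le
      (Finsupp.single_le_iff.2 (Nat.one_le_iff_ne_zero.2 hi)), hm, zero_mul]
  · rfl

/-- `f₀` is the homogeneous component of `f` of degree `d`, and `f` has no components of higher
degree. Unlike for the leading form, `f₀ = 0` is allowed: it means `deg f < d`. -/
def HasTop (d : ℕ) (f f₀ : MvPolynomial (Fin n) k) : Prop :=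
  f₀.IsHomogeneous d ∧ deg (f - f₀) < (d : WithBot ℕ)

namespace HasTop

theorem deg_le (h : HasTop d f f₀) : deg f ≤ (d : WithBot ℕ) := by
  have := deg_add_le (f - f₀) f₀
  rw [sub_add_cancel] at this
  exact this.trans (max_le h.2.le (deg_le_of_isHomogeneous h.1))

theorem mul (hf : HasTop d f f₀) (hg : HasTop e g g₀) : HasTop (d + e) (f * g) (f₀ * g₀) := by
  refine ⟨hf.1.mul hg.1, ?_⟩
  have : f * g - f₀ * g₀ = (f - f₀) * g + f₀ * (g - g₀) := by ring
  rw [this]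
  refine (deg_add_le _ _).trans_lt (max_lt ?_ ?_)
  · rw [deg_mul]
    exact add_lt_coe_of_lt_of_le hf.2 hg.deg_le
  · rw [deg_mul, add_comm, add_comm d]
    exact add_lt_coe_of_lt_of_le hg.2 (deg_le_of_isHomogeneous hf.1)

theorem zero : HasTop d (0 : MvPolynomial (Fin n) k) 0 :=
  ⟨isHomogeneous_zero _ _ _, by simp [deg_zero]⟩

theorem one : HasTop 0 (1 : MvPolynomial (Fin n) k) 1 :=
  ⟨isHomogeneous_one _ _, by simp [deg_zero]⟩

theorem add (hf : HasTop d f f₀) (hg : HasTop d g g₀) : HasTop d (f + g) (f₀ + g₀) := by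
  refine ⟨hf.1.add hg.1, ?_⟩
  rw [add_sub_add_comm]
  exact (deg_add_le _ _).trans_lt (max_lt hf.2 hg.2)

theorem smul (hf : HasTop d f f₀) (c : k) : HasTop d (c • f) (c • f₀) := by
  refine ⟨?_, ?_⟩
  · rw [smul_eq_C_mul]
    exact hf.1.C_mul c
  · rw [← smul_sub]
    exact (deg_smul_le _ _).trans_lt hf.2

theorem sub (hf : HasTop d f f₀) (hg : HasTop d g g₀) : HasTop d (f - g) (f₀ - g₀) := by
  simpa [sub_eq_add_neg] using hf.add (hg.smul (-1))

theorem pow (hf : HasTop d f f₀) (m : ℕ) : HasTop (m * d) (f ^ m) (f₀ ^ m) := by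
  induction m with
  | zero => simpa using one
  | succ m ih => rw [pow_succ, pow_succ, Nat.succ_mul]; exact ih.mul hf

theorem of_deg_lt (h : deg f < (d : WithBot ℕ)) : HasTop d f 0 :=
  ⟨isHomogeneous_zero _ _ _, by simpa using h⟩

theorem deg_lt (h : HasTop d f 0) : deg f < (d : WithBot ℕ) := by simpa using h.2

theorem unique (hf : HasTop d f f₀) (hg : HasTop d f g₀) : f₀ = g₀ := by
  by_contra hne
  have h1 := hf.sub hg
  rw [sub_self] at h1
  have := h1.2
  rw [zero_sub, deg_neg, deg_eq_of_isHomogeneous h1.1 (sub_ne_zero.2 hne)] at this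
  exact lt_irrefl _ this

theorem deg_eq (h : HasTop d f f₀) (h0 : f₀ ≠ 0) : deg f = (d : WithBot ℕ) := by
  refine le_antisymm h.deg_le (le_of_not_gt fun hlt => h0 (h.unique (of_deg_lt hlt)))

theorem of_deg_eq (h : deg f = (d : WithBot ℕ)) : HasTop d f (lead f) := by
  have hf := ne_zero_of_deg_eq h
  have hd : f.totalDegree = d := by
    rw [deg_eq_totalDegree hf] at h
    exact_mod_cast h
  subst hd
  refine ⟨homogeneousComponent_isHomogeneous _ _, ?_⟩
  refine (Finset.sup_lt_iff (WithBot.bot_lt_coe _)).2 fun m hm => ?_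
  refine WithBot.coe_lt_coe.2 ?_
  rw [mem_support_iff, coeff_sub, lead, coeff_homogeneousComponent] at hm
  have hne : m.degree ≠ f.totalDegree := fun h => hm (by simp [h])
  have hcoeff : coeff m f ≠ 0 := by simpa [hne] using hm
  have hle : m.degree ≤ f.totalDegree := le_totalDegree (mem_support_iff.2 hcoeff)
  have hw : Finsupp.weight (fun _ : Fin n => (1 : ℕ)) m = m.degree :=
    (DFunLike.congr_fun (Finsupp.degree_eq_weight_one (R := ℕ)) m).symm
  rw [hw]
  exact lt_of_le_of_ne hle hne

theorem lead_eq (h : HasTop d f f₀) (h0 : f₀ ≠ 0) : lead f = f₀ :=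
  (of_deg_eq (h.deg_eq h0)).unique h

end HasTop

theorem lead_ne_zero (hf : f ≠ 0) : lead f ≠ 0 := fun h => by
  have h1 := HasTop.of_deg_eq (deg_eq_totalDegree hf)
  rw [h] at h1
  exact absurd h1.deg_lt (by rw [deg_eq_totalDegree hf]; exact lt_irrefl _)

end DegreeArithmetic

end SURed

/-! ### Degrees of differential forms -/

namespace SURed

open MvPolynomial

section Forms

variable {k : Type*} [Field k] {n l : ℕ}

theorem formDeg_add_le
    (ω η : ⋀[MvPolynomial (Fin n) k]^l (Ω[MvPolynomial (Fin n) k⁄k])) :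
    formDeg (ω + η) ≤ max (formDeg ω) (formDeg η) := by
  refine Finset.sup_le fun s _ => ?_
  rw [map_add, Finsupp.add_apply, add_mul]
  refine (deg_add_le _ _).trans (max_le_max ?_ ?_)
  · exact Finset.le_sup (f := fun s : Set.powersetCard (Fin n) l =>
      deg ((((KaehlerDifferential.mvPolynomialBasis k (Fin n)).exteriorPower l).repr ω s) *
        ∏ i ∈ (s : Finset (Fin n)), X i)) (Finset.mem_univ s)
  · exact Finset.le_sup (f := fun s : Set.powersetCard (Fin n) l =>
      deg ((((KaehlerDifferential.mvPolynomialBasis k (Fin n)).exteriorPower l).repr η s) *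
        ∏ i ∈ (s : Finset (Fin n)), X i)) (Finset.mem_univ s)

theorem formDeg_smul (f : MvPolynomial (Fin n) k)
    (ω : ⋀[MvPolynomial (Fin n) k]^l (Ω[MvPolynomial (Fin n) k⁄k])) :
    formDeg (f • ω) = deg f + formDeg ω := by
  unfold formDeg
  simp only [map_smul, Finsupp.smul_apply, smul_eq_mul, mul_assoc, deg_mul f]
  rw [Finset.apply_sup_eq_sup_comp (fun x => deg f + x)]
  · rfl
  · intro x y
    exact (max_add_add_left (deg f) x y).symm
  · simp

/-- A nonzero `l`-form has degree at least `l`. -/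
theorem le_formDeg {ω : ⋀[MvPolynomial (Fin n) k]^l (Ω[MvPolynomial (Fin n) k⁄k])}
    (h : formDeg ω ≠ ⊥) : (l : WithBot ℕ) ≤ formDeg ω := by
  obtain ⟨s, -, hs⟩ : ∃ s ∈ (Finset.univ : Finset (Set.powersetCard (Fin n) l)),
      deg ((((KaehlerDifferential.mvPolynomialBasis k (Fin n)).exteriorPower l).repr ω s) *
        ∏ i ∈ (s : Finset (Fin n)), X i) ≠ ⊥ := by
    by_contra! hcon
    exact h ((Finset.sup_eq_bot_iff _ _).2 hcon)
  refine le_trans ?_ (Finset.le_sup (f := fun s : Set.powersetCard (Fin n) l =>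
      deg ((((KaehlerDifferential.mvPolynomialBasis k (Fin n)).exteriorPower l).repr ω s) *
        ∏ i ∈ (s : Finset (Fin n)), X i)) (Finset.mem_univ s))
  rw [Ne, deg_eq_bot] at hs
  rw [deg_mul]
  have hprod : (∏ i ∈ (s : Finset (Fin n)), X i : MvPolynomial (Fin n) k).IsHomogeneous l := by
    have := IsHomogeneous.prod (s : Finset (Fin n)) (fun i => (X i : MvPolynomial (Fin n) k))
      (fun _ => 1) (fun i _ => isHomogeneous_X k i)
    simpa [Set.powersetCard.card_eq s] using this
  rw [deg_eq_of_isHomogeneous hprod (right_ne_zero_of_mul hs),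
    deg_eq_totalDegree (left_ne_zero_of_mul hs)]
  exact_mod_cast Nat.le_add_left _ _

theorem formDeg_dwedge_le (f g : MvPolynomial (Fin n) k) :
    formDeg (dwedge f g) ≤ deg f + deg g := by
  refine Finset.sup_le fun s _ => ?_
  rw [exteriorPower.basis_repr_apply, dwedge, exteriorPower.ιMultiDual_apply_ιMulti,
    Matrix.det_fin_two]
  set e := Set.powersetCard.ofFinEmbEquiv.symm s with he
  have hs : (s : Finset (Fin n)) = {e 0, e 1} := by
    ext i
    rw [Set.powersetCard.mem_coe_iff, ← Set.powersetCard.mem_range_ofFinEmbEquiv_symm_iff_mem]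
    simp [← he, Fin.exists_fin_two, eq_comm]
  have hne : e 0 ≠ e 1 := fun h => by simpa using e.injective h
  rw [hs, Finset.prod_pair hne]
  simp only [Matrix.of_apply, Module.Basis.coord_apply, Matrix.cons_val_zero,
    Matrix.cons_val_one, KaehlerDifferential.mvPolynomialBasis_repr_apply]
  have h : (pderiv (e 0) f * pderiv (e 1) g - pderiv (e 1) f * pderiv (e 0) g) *
      (X (e 0) * X (e 1)) = (X (e 0) * pderiv (e 0) f) * (X (e 1) * pderiv (e 1) g) -
      (X (e 1) * pderiv (e 1) f) * (X (e 0) * pderiv (e 0) g) := by ring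
  rw [h]
  refine (deg_sub_le _ _).trans (max_le ?_ ?_) <;> rw [deg_mul] <;>
    exact add_le_add (deg_X_mul_pderiv_le _ _) (deg_X_mul_pderiv_le _ _)

/-- The linear map `η ↦ df ∧ η` from 1-forms to 2-forms. -/
noncomputable def wedgeD (f : MvPolynomial (Fin n) k) :
    Ω[MvPolynomial (Fin n) k⁄k] →ₗ[MvPolynomial (Fin n) k]
      ⋀[MvPolynomial (Fin n) k]^2 (Ω[MvPolynomial (Fin n) k⁄k]) :=
  (exteriorPower.ιMulti (MvPolynomial (Fin n) k) 2).toMultilinearMap.toLinearMap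
    ![KaehlerDifferential.D k (MvPolynomial (Fin n) k) f, 0] 1

theorem dwedge_eq_wedgeD (f g : MvPolynomial (Fin n) k) :
    dwedge f g = wedgeD f (KaehlerDifferential.D k (MvPolynomial (Fin n) k) g) := by
  rw [wedgeD, MultilinearMap.toLinearMap_apply, dwedge]
  have : Function.update ![KaehlerDifferential.D k (MvPolynomial (Fin n) k) f, 0] 1
      (KaehlerDifferential.D k (MvPolynomial (Fin n) k) g) =
      ![KaehlerDifferential.D k (MvPolynomial (Fin n) k) f,
        KaehlerDifferential.D k (MvPolynomial (Fin n) k) g] := by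
    ext i
    fin_cases i <;> rfl
  rw [this]
  rfl

theorem dwedge_add_right (f g h : MvPolynomial (Fin n) k) :
    dwedge f (g + h) = dwedge f g + dwedge f h := by
  simp only [dwedge_eq_wedgeD, map_add]

theorem dwedge_smul_right (c : k) (f g : MvPolynomial (Fin n) k) :
    dwedge f (c • g) = (C c : MvPolynomial (Fin n) k) • dwedge f g := by
  rw [dwedge_eq_wedgeD, dwedge_eq_wedgeD, ← map_smul, Derivation.map_smul,
    ← algebraMap_smul (MvPolynomial (Fin n) k) c, algebraMap_eq]

theorem dwedge_self (f : MvPolynomial (Fin n) k) : dwedge f f = 0 :=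
  (exteriorPower.ιMulti (MvPolynomial (Fin n) k) 2).map_eq_zero_of_eq _
    (i := 0) (j := 1) rfl (by simp)

theorem dwedge_mul_right (f g h : MvPolynomial (Fin n) k) :
    dwedge f (g * h) = g • dwedge f h + h • dwedge f g := by
  simp only [dwedge_eq_wedgeD, Derivation.leibniz, map_add, map_smul]

/-- The chain rule for `dh ∧ d(Ψ(g₁, …, g_r))`. -/
theorem dwedge_aeval {r : ℕ} (h : MvPolynomial (Fin n) k) (g : Fin r → MvPolynomial (Fin n) k)
    (Ψ : MvPolynomial (Fin r) k) :
    dwedge h (aeval g Ψ) = ∑ i, aeval g (pderiv i Ψ) • dwedge h (g i) := by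
  induction Ψ using MvPolynomial.induction_on with
  | C c => simp [dwedge_eq_wedgeD]
  | add p q hp hq => simp only [map_add, dwedge_add_right, hp, hq, add_smul, Finset.sum_add_distrib]
  | mul_X p i hp =>
    rw [map_mul, aeval_X, dwedge_mul_right, hp, Finset.smul_sum]
    have : ∀ j, aeval g (pderiv j (p * X i)) • dwedge h (g j) =
        (aeval g p * if i = j then 1 else 0) • dwedge h (g j) +
          g i • aeval g (pderiv j p) • dwedge h (g j) := by
      intro j
      rw [pderiv_mul, map_add, add_smul, add_comm]
      congr 1
      · rw [pderiv_X, map_mul]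
        congr 2
        by_cases hij : j = i
        · subst hij; simp
        · rw [Pi.single_eq_of_ne (Ne.symm hij), if_neg (Ne.symm hij), map_zero]
      · rw [map_mul, aeval_X, mul_comm, mul_smul]
    simp only [this, Finset.sum_add_distrib]
    congr 1
    simp

theorem dwedge_swap (f g : MvPolynomial (Fin n) k) : dwedge f g = -dwedge g f := by
  have := (exteriorPower.ιMulti (MvPolynomial (Fin n) k) 2).map_swap
    ![KaehlerDifferential.D k (MvPolynomial (Fin n) k) g,
      KaehlerDifferential.D k (MvPolynomial (Fin n) k) f] (i := 0) (j := 1) (by simp)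
  rw [dwedge, dwedge, ← this]
  congr 1
  ext i
  fin_cases i <;> simp

end Forms

end SURed

/-! ### Weighted leading forms in two variables -/

namespace SURed

open MvPolynomial

section WeightedTop

variable {k : Type*} [Field k] {n : ℕ} {e₀ e₁ D : ℕ} {Ψ H : MvPolynomial (Fin 2) k}

/-- `H` is the component of `Ψ` of degree `D` for the weights `e₀, e₁` of the two variables, and
`Ψ` has no components of higher degree; `H = 0` is allowed. -/
def HasWTop (e₀ e₁ D : ℕ) (Ψ H : MvPolynomial (Fin 2) k) : Prop :=
  (∀ m ∈ H.support, m 0 * e₀ + m 1 * e₁ = D) ∧ ∀ m ∈ (Ψ - H).support, m 0 * e₀ + m 1 * e₁ < D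

theorem HasWTop.exists (e₀ e₁ : ℕ) (hΨ : Ψ ≠ 0) : ∃ D H, HasWTop e₀ e₁ D Ψ H ∧ H ≠ 0 := by
  classical
  obtain ⟨m, hm, hmax⟩ := Ψ.support.exists_max_image (fun m => m 0 * e₀ + m 1 * e₁)
    (support_nonempty.2 hΨ)
  have hw : ∀ m : Fin 2 →₀ ℕ, Finsupp.weight ![e₀, e₁] m = m 0 * e₀ + m 1 * e₁ := fun m => by
    simp [Finsupp.weight_apply, Finsupp.sum_fintype]
  refine ⟨m 0 * e₀ + m 1 * e₁,
    weightedHomogeneousComponent ![e₀, e₁] (m 0 * e₀ + m 1 * e₁) Ψ, ⟨?_, ?_⟩, ?_⟩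
  · intro m' hm'
    rw [mem_support_iff, coeff_weightedHomogeneousComponent, hw] at hm'
    by_contra h
    simp [h] at hm'
  · intro m' hm'
    rw [mem_support_iff, coeff_sub, coeff_weightedHomogeneousComponent, hw] at hm'
    have hne : m' 0 * e₀ + m' 1 * e₁ ≠ m 0 * e₀ + m 1 * e₁ := fun h => by simp [h] at hm'
    have : m' ∈ Ψ.support := by simpa [hne] using hm'
    exact lt_of_le_of_ne (hmax m' this) hne
  · intro h
    have := congrArg (coeff m) h
    rw [coeff_weightedHomogeneousComponent, hw, if_pos rfl, coeff_zero] at this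
    exact mem_support_iff.1 hm this

theorem HasWTop.pderiv {D' : ℕ} (h : HasWTop e₀ e₁ D Ψ H) (i : Fin 2)
    (hD : D' + ![e₀, e₁] i = D) : HasWTop e₀ e₁ D' (pderiv i Ψ) (pderiv i H) := by
  have hs : ∀ (p : MvPolynomial (Fin 2) k) (m : Fin 2 →₀ ℕ),
      m ∈ (MvPolynomial.pderiv i p).support → m + Finsupp.single i 1 ∈ p.support := by
    intro p m hm
    rw [mem_support_iff, coeff_pderiv] at hm
    exact mem_support_iff.2 (left_ne_zero_of_mul hm)
  refine ⟨fun m hm => ?_, fun m hm => ?_⟩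
  · have := h.1 _ (hs _ _ hm)
    fin_cases i <;> simp at this hD <;> linarith
  · rw [← map_sub] at hm
    have := h.2 _ (hs _ _ hm)
    fin_cases i <;> simp at this hD <;> linarith

theorem aeval_eq_sum {A : Type*} [CommRing A] [Algebra k A] (x y : A)
    (p : MvPolynomial (Fin 2) k) :
    aeval ![x, y] p = ∑ m ∈ p.support, coeff m p • (x ^ m 0 * y ^ m 1) := by
  rw [aeval_def, eval₂_eq']
  refine Finset.sum_congr rfl fun m _ => ?_
  rw [Fin.prod_univ_two, Algebra.smul_def]
  rfl

/-- Substituting polynomials with leading forms `u, v` into `Ψ`, the top form of `Ψ` becomes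
the top form of the result, as long as it does not vanish at `(u, v)`. -/
theorem HasWTop.aeval {g₀ g₁ u v : MvPolynomial (Fin n) k} (h : HasWTop e₀ e₁ D Ψ H)
    (h₀ : HasTop e₀ g₀ u) (h₁ : HasTop e₁ g₁ v) :
    HasTop D (aeval ![g₀, g₁] Ψ) (aeval ![u, v] H) := by
  have hmon : ∀ m : Fin 2 →₀ ℕ,
      HasTop (m 0 * e₀ + m 1 * e₁) (g₀ ^ m 0 * g₁ ^ m 1) (u ^ m 0 * v ^ m 1) :=
    fun m => (h₀.pow _).mul (h₁.pow _)
  have hsum : ∀ (s : Finset (Fin 2 →₀ ℕ)) (c : (Fin 2 →₀ ℕ) → k)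
      (F F₀ : (Fin 2 →₀ ℕ) → MvPolynomial (Fin n) k), (∀ m ∈ s, HasTop D (F m) (F₀ m)) →
      HasTop D (∑ m ∈ s, c m • F m) (∑ m ∈ s, c m • F₀ m) := by
    classical
    intro s c F F₀
    induction s using Finset.induction_on with
    | empty => intro _; simpa using HasTop.zero
    | insert a s ha ih =>
      intro hs
      rw [Finset.sum_insert ha, Finset.sum_insert ha]
      exact ((hs a (Finset.mem_insert_self _ _)).smul _).add
        (ih fun m hm => hs m (Finset.mem_insert_of_mem hm))
  have hH : HasTop D (MvPolynomial.aeval ![g₀, g₁] H) (MvPolynomial.aeval ![u, v] H) := by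
    rw [aeval_eq_sum, aeval_eq_sum]
    refine hsum _ _ _ _ fun m hm => ?_
    have := hmon m
    rwa [h.1 m hm] at this
  have hL : HasTop D (MvPolynomial.aeval ![g₀, g₁] (Ψ - H)) 0 := by
    rw [aeval_eq_sum]
    have := hsum (Ψ - H).support (fun m => coeff m (Ψ - H)) (fun m => g₀ ^ m 0 * g₁ ^ m 1)
      (fun _ => 0) fun m hm => HasTop.of_deg_lt
        ((hmon m).deg_le.trans_lt (by exact_mod_cast h.2 m hm))
    simpa using this
  have := hH.add hL
  rwa [map_sub, add_sub_cancel, add_zero] at this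

/-- Euler's identity for the top form. -/
theorem HasWTop.euler (h : HasWTop e₀ e₁ D Ψ H) :
    (e₀ : MvPolynomial (Fin 2) k) * (X 0 * MvPolynomial.pderiv 0 H) +
      (e₁ : MvPolynomial (Fin 2) k) * (X 1 * MvPolynomial.pderiv 1 H) =
      (D : MvPolynomial (Fin 2) k) * H := by
  have hH : H.IsWeightedHomogeneous ![e₀, e₁] D := fun m hm => by
    rw [← h.1 m (mem_support_iff.2 hm)]
    simp [Finsupp.weight_apply, Finsupp.sum_fintype]
  have := hH.sum_weight_X_mul_pderiv
  simpa [Fin.sum_univ_two, nsmul_eq_mul] using this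

end WeightedTop

section Slice

theorem derivative_ne_zero_of_isRoot {A : Type*} [CommRing A] [IsDomain A] [CharZero A]
    {p : Polynomial A} {u : A} (hp : p ≠ 0) (hu : p.IsRoot u) : Polynomial.derivative p ≠ 0 := by
  intro h
  rw [Polynomial.derivative_eq_zero] at h
  rw [Polynomial.eq_C_of_natDegree_eq_zero h, Polynomial.IsRoot, Polynomial.eval_C] at hu
  exact hp (by rw [Polynomial.eq_C_of_natDegree_eq_zero h, hu, map_zero])

variable {k : Type*} [Field k] {A : Type*} [CommRing A] [Algebra k A]
  {e₀ e₁ D : ℕ} {Ψ H : MvPolynomial (Fin 2) k}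

/-- The univariate polynomial `H(T, v)`. -/
noncomputable def slice (v : A) (H : MvPolynomial (Fin 2) k) : Polynomial A :=
  aeval ![Polynomial.X, Polynomial.C v] H

theorem slice_eq_sum (v : A) (H : MvPolynomial (Fin 2) k) :
    slice v H = ∑ m ∈ H.support,
      Polynomial.monomial (m 0) (algebraMap k A (coeff m H) * v ^ m 1) := by
  rw [slice, aeval_eq_sum]
  refine Finset.sum_congr rfl fun m _ => ?_
  rw [← Polynomial.C_mul_X_pow_eq_monomial, Algebra.smul_def, Polynomial.algebraMap_apply,
    map_mul, map_pow]
  ring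

theorem eval_slice (u v : A) (H : MvPolynomial (Fin 2) k) :
    (slice v H).eval u = aeval ![u, v] H := by
  rw [slice_eq_sum, aeval_eq_sum, Polynomial.eval_finsetSum]
  refine Finset.sum_congr rfl fun m _ => ?_
  rw [Polynomial.eval_monomial, Algebra.smul_def]
  ring

theorem derivative_slice (v : A) (H : MvPolynomial (Fin 2) k) :
    Polynomial.derivative (slice v H) = slice v (pderiv 0 H) := by
  induction H using MvPolynomial.induction_on with
  | C c => simp [slice, Polynomial.algebraMap_apply]
  | add p q hp hq => simp only [slice, map_add] at hp hq ⊢; rw [hp, hq]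
  | mul_X p i hp =>
    simp only [slice] at hp
    fin_cases i <;> simp [slice, pderiv_X, hp] <;> ring

/-- For each `i` the top form `H` has at most one monomial of degree `i` in the first variable. -/
theorem HasWTop.slice_ne_zero [IsDomain A] (h : HasWTop e₀ e₁ D Ψ H) (hH : H ≠ 0)
    (he₁ : 0 < e₁) {v : A} (hv : v ≠ 0) : slice v H ≠ 0 := by
  obtain ⟨m, hm⟩ := support_nonempty.2 hH
  intro h0
  have := congrArg (fun p => Polynomial.coeff p (m 0)) h0
  simp only [slice_eq_sum, Polynomial.finsetSum_coeff, Polynomial.coeff_zero,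
    Polynomial.coeff_monomial] at this
  rw [Finset.sum_eq_single_of_mem m hm, if_pos rfl] at this
  · have h1 : algebraMap k A (coeff m H) ≠ 0 := by
      simpa using mem_support_iff.1 hm
    exact mul_ne_zero h1 (pow_ne_zero _ hv) this
  · intro m' hm' hne
    rw [if_neg]
    intro h00
    refine hne ?_
    have h1 := h.1 m hm
    rw [← h.1 m' hm', h00] at h1
    have h11 : m 1 = m' 1 := Nat.eq_of_mul_eq_mul_right he₁ (Nat.add_left_cancel h1)
    ext i
    fin_cases i
    · exact h00
    · exact h11.symm

theorem HasWTop.natDegree_slice_le (h : HasWTop e₀ e₁ D Ψ H) (he₀ : 0 < e₀) (v : A) :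
    (slice v H).natDegree * e₀ ≤ D := by
  have : (slice v H).natDegree ≤ D / e₀ := by
    rw [slice_eq_sum]
    refine Polynomial.natDegree_sum_le_of_forall_le _ _ fun m hm => ?_
    refine (Polynomial.natDegree_monomial_le _).trans ?_
    rw [Nat.le_div_iff_mul_le he₀]
    have := h.1 m hm
    omega
  exact (Nat.mul_le_mul_right _ this).trans (Nat.div_mul_le_self _ _)

/-- If the weights are `sδ` and `2δ` with `s` odd, then `H(T, v)` is an even or an odd function of
`T`, so `-u` is a root of the same multiplicity as `u`. -/
theorem HasWTop.two_mul_rootMultiplicity_le [IsDomain A] [CharZero A] {s δ : ℕ}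
    (hs : Odd s) (hδ : 0 < δ) (h : HasWTop (s * δ) (2 * δ) D Ψ H) (hH : H ≠ 0) {u v : A}
    (hu : u ≠ 0) (hv : v ≠ 0) :
    2 * (slice v H).rootMultiplicity u * (s * δ) ≤ D := by
  classical
  have hp := h.slice_ne_zero hH (by positivity) hv
  set p := slice v H with hpdef
  obtain ⟨m₀, hm₀⟩ := support_nonempty.2 hH
  have hcomp : p.comp (-Polynomial.X) = (-1) ^ m₀ 0 * p := by
    rw [hpdef, slice_eq_sum, Polynomial.sum_comp, Finset.mul_sum]
    refine Finset.sum_congr rfl fun m hm => ?_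
    have hpar : (-1 : Polynomial A) ^ m 0 = (-1) ^ m₀ 0 := by
      have h1 : m 0 * s + m 1 * 2 = m₀ 0 * s + m₀ 1 * 2 := by
        have h2 := (h.1 m hm).trans (h.1 m₀ hm₀).symm
        refine Nat.eq_of_mul_eq_mul_right hδ ?_
        linarith
      have h3 : Even (m 0) ↔ Even (m₀ 0) := by
        have h4 : Even (m 0 * s + m 1 * 2) ↔ Even (m₀ 0 * s + m₀ 1 * 2) := by rw [h1]
        have : ¬ Even s := Nat.not_even_iff_odd.2 hs
        simpa [Nat.even_add, Nat.even_mul, this] using h4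
      rcases Nat.even_or_odd (m 0) with he | ho
      · rw [he.neg_one_pow, (h3.1 he).neg_one_pow]
      · rw [ho.neg_one_pow, (Nat.not_even_iff_odd.1 fun h5 =>
          Nat.not_even_iff_odd.2 ho (h3.2 h5)).neg_one_pow]
    rw [Polynomial.monomial_comp, ← Polynomial.C_mul_X_pow_eq_monomial, neg_pow, hpar]
    ring
  set r := p.rootMultiplicity u with hr
  have hdvd : (Polynomial.X - Polynomial.C (-u)) ^ r ∣ p := by
    obtain ⟨q, hq⟩ := Polynomial.pow_rootMultiplicity_dvd p u
    rw [← hr] at hq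
    refine ⟨(-1) ^ m₀ 0 * (-1) ^ r * q.comp (-Polynomial.X), ?_⟩
    have h1 : ((-1 : Polynomial A) ^ m₀ 0) * (-1) ^ m₀ 0 = 1 := by
      rw [← mul_pow]; simp
    have h2 : p = (-1) ^ m₀ 0 * p.comp (-Polynomial.X) := by
      rw [hcomp, ← mul_assoc, h1, one_mul]
    have h3 : p.comp (-Polynomial.X) =
        (-1) ^ r * (Polynomial.X - Polynomial.C (-u)) ^ r * q.comp (-Polynomial.X) := by
      conv_lhs => rw [hq]
      rw [Polynomial.mul_comp, Polynomial.pow_comp, Polynomial.sub_comp, Polynomial.X_comp,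
        Polynomial.C_comp, ← mul_pow, map_neg]
      ring
    rw [h3] at h2
    rw [h2]
    ring
  have hneg : r ≤ p.rootMultiplicity (-u) := (Polynomial.le_rootMultiplicity_iff hp).2 hdvd
  have hne : u ≠ -u := fun h => hu (self_eq_neg.1 h)
  have hle : Multiset.replicate r u + Multiset.replicate r (-u) ≤ p.roots := by
    rw [Multiset.le_iff_count]
    intro a
    rw [Multiset.count_add, Multiset.count_replicate, Multiset.count_replicate,
      Polynomial.count_roots]
    by_cases h1 : a = u
    · subst h1
      simp [hne.symm, hr]
    · by_cases h2 : a = -u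
      · subst h2
        simpa [hne] using hneg
      · simp [Ne.symm h1, Ne.symm h2]
  have hcard := (Multiset.card_le_card hle).trans (Polynomial.card_roots' p)
  rw [Multiset.card_add, Multiset.card_replicate, Multiset.card_replicate, ← two_mul] at hcard
  have hs0 : 0 < s := hs.pos
  exact (Nat.mul_le_mul_right _ hcard).trans (h.natDegree_slice_le (by positivity) v)

end Slice

/-! ### The Shestakov–Umirbaev inequality -/

section Inequality

variable {k : Type*} [Field k] {n e₀ e₁ D N : ℕ} {Ψ H : MvPolynomial (Fin 2) k}
  {g₀ g₁ u v : MvPolynomial (Fin n) k}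

/-- The identity `dg₁ ∧ dΨ(g₀, g₁) = Ψ₀(g₀, g₁) dg₁ ∧ dg₀`, read as a bound for the degree of a
partial derivative. -/
theorem deg_aeval_pderiv_le (h₁ : deg g₁ = (e₁ : WithBot ℕ))
    (hN : formDeg (dwedge g₁ g₀) = (N : WithBot ℕ)) (Ψ : MvPolynomial (Fin 2) k) :
    deg (aeval ![g₀, g₁] (pderiv 0 Ψ)) + (N : WithBot ℕ) ≤
      (e₁ : WithBot ℕ) + deg (aeval ![g₀, g₁] Ψ) := by
  have h := formDeg_dwedge_le g₁ (aeval ![g₀, g₁] Ψ)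
  rw [dwedge_aeval, Fin.sum_univ_two] at h
  simpa [dwedge_self, formDeg_smul, hN, h₁] using h

/-- Each differentiation lowers the multiplicity of the root `u` of `H(T, v)` by one; when it has
reached zero, nothing cancels any more. -/
theorem HasWTop.le_deg_aeval [CharZero k] (he₁ : 0 < e₁) (h₀ : HasTop e₀ g₀ u) (h₁ : HasTop e₁ g₁ v)
    (hv : v ≠ 0) (hN : formDeg (dwedge g₁ g₀) = (N : WithBot ℕ)) (r : ℕ) :
    ∀ {D : ℕ} {Ψ H : MvPolynomial (Fin 2) k}, HasWTop e₀ e₁ D Ψ H → H ≠ 0 →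
      (slice v H).rootMultiplicity u = r →
      ((D + r * N : ℕ) : WithBot ℕ) ≤
        deg (MvPolynomial.aeval ![g₀, g₁] Ψ) + ((r * (e₀ + e₁) : ℕ) : WithBot ℕ) := by
  induction r with
  | zero =>
    intro D Ψ H h hH hr
    have hroot : (slice v H).eval u ≠ 0 := fun h0 =>
      ((Polynomial.rootMultiplicity_pos (h.slice_ne_zero hH he₁ hv)).2 h0).ne' hr
    rw [eval_slice] at hroot
    rw [(h.aeval h₀ h₁).deg_eq hroot]
    simp
  | succ r ih =>
    intro D Ψ H h hH hr
    have hp := h.slice_ne_zero hH he₁ hv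
    have hroot : (slice v H).IsRoot u :=
      (Polynomial.rootMultiplicity_pos hp).1 (by omega)
    have hr' := Polynomial.derivative_rootMultiplicity_of_root hroot
    rw [derivative_slice, hr, Nat.add_sub_cancel] at hr'
    have hH' : MvPolynomial.pderiv 0 H ≠ 0 := by
      intro h0
      refine derivative_ne_zero_of_isRoot hp hroot ?_
      rw [derivative_slice, h0, slice, map_zero]
    obtain ⟨m, hm⟩ := support_nonempty.2 hH'
    have hD : D - e₀ + e₀ = D := by
      have hm' : m + Finsupp.single 0 1 ∈ H.support := by
        rw [mem_support_iff, coeff_pderiv] at hm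
        exact mem_support_iff.2 (left_ne_zero_of_mul hm)
      have := h.1 _ hm'
      simp only [Finsupp.add_apply, Finsupp.single_apply, add_mul] at this
      simp at this
      omega
    have hih := ih (h.pderiv 0 (D' := D - e₀) (by simpa using hD)) hH' hr'
    have hder := deg_aeval_pderiv_le (h₁.deg_eq hv) hN Ψ
    generalize deg (MvPolynomial.aeval ![g₀, g₁] (MvPolynomial.pderiv 0 Ψ)) = a at hih hder
    generalize deg (MvPolynomial.aeval ![g₀, g₁] Ψ) = b at hder ⊢
    induction a with
    | bot =>
      rw [WithBot.bot_add, le_bot_iff] at hih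
      exact absurd hih WithBot.coe_ne_bot
    | coe a =>
      induction b with
      | bot =>
        rw [WithBot.add_bot, le_bot_iff] at hder
        exact absurd hder (WithBot.coe_ne_bot (a := a + N))
      | coe b =>
        have h2 : a + N ≤ e₁ + b := WithBot.coe_le_coe.1 hder
        have h3 : D - e₀ + r * N ≤ a + r * (e₀ + e₁) := WithBot.coe_le_coe.1 hih
        refine WithBot.coe_le_coe.2 (show D + (r + 1) * N ≤ b + (r + 1) * (e₀ + e₁) from ?_)
        rw [Nat.succ_mul, Nat.succ_mul]
        omega

/-- The Shestakov–Umirbaev inequality for `φ = Ψ(g₀, g₁)`, where `2 deg g₀ = s deg g₁` with `s` odd.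
Here `D` is the weighted degree of `Ψ` and `r` counts how often the top form of `Ψ` vanishes at
the leading forms `(u, v)`. -/
theorem exists_shestakov_umirbaev [CharZero k] {s δ : ℕ} (hs : Odd s) (hδ : 0 < δ)
    (h₀ : HasTop (s * δ) g₀ u) (h₁ : HasTop (2 * δ) g₁ v) (hu : u ≠ 0) (hv : v ≠ 0)
    (hN : formDeg (dwedge g₁ g₀) = (N : WithBot ℕ)) (hΨ : Ψ ≠ 0) :
    ∃ D r : ℕ, 2 * r * (s * δ) ≤ D ∧
      ((D + r * N : ℕ) : WithBot ℕ) ≤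
        deg (aeval ![g₀, g₁] Ψ) + ((r * (s * δ + 2 * δ) : ℕ) : WithBot ℕ) ∧
      (r = 0 → lead (aeval ![g₀, g₁] Ψ) ∈ Algebra.adjoin k {u, v}) ∧
      (r = 1 → deg (aeval ![g₀, g₁] (pderiv 1 Ψ)) = ((D - 2 * δ : ℕ) : WithBot ℕ)) := by
  obtain ⟨D, H, h, hH⟩ := HasWTop.exists (s * δ) (2 * δ) hΨ
  have hs0 : 0 < s := hs.pos
  have hmul := h.two_mul_rootMultiplicity_le hs hδ hH hu hv
  have hp := h.slice_ne_zero hH (by positivity : 0 < 2 * δ) hv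
  refine ⟨D, (slice v H).rootMultiplicity u, hmul,
    h.le_deg_aeval (by positivity) h₀ h₁ hv hN _ hH rfl, fun hr => ?_, fun hr => ?_⟩
  · have hroot : (slice v H).eval u ≠ 0 := fun h0 =>
      ((Polynomial.rootMultiplicity_pos hp).2 h0).ne' hr
    rw [eval_slice] at hroot
    rw [(h.aeval h₀ h₁).lead_eq hroot]
    have hrange : ∀ p : MvPolynomial (Fin 2) k,
        aeval ![u, v] p ∈ Algebra.adjoin k (Set.range ![u, v]) := fun p => by
      rw [Algebra.adjoin_range_eq_range_aeval]
      exact ⟨p, rfl⟩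
    simpa [Matrix.range_cons, Matrix.range_empty, Set.pair_comm] using hrange H
  · have hroot : (slice v H).IsRoot u := (Polynomial.rootMultiplicity_pos hp).1 (by omega)
    have hr' := Polynomial.derivative_rootMultiplicity_of_root hroot
    rw [derivative_slice, hr, Nat.sub_self] at hr'
    -- A simple root of `H(T, v)` is not a root of its derivative; by Euler's identity the other
    -- partial derivative of `H` does not vanish at `(u, v)` either.
    have h0 : aeval ![u, v] (pderiv 0 H) ≠ 0 := by
      rw [← eval_slice]
      intro h0
      have hne : slice v (pderiv 0 H) ≠ 0 := by
        rw [← derivative_slice]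
        exact derivative_ne_zero_of_isRoot hp hroot
      exact ((Polynomial.rootMultiplicity_pos hne).2 h0).ne' hr'
    have hEuler := congrArg (aeval ![u, v]) h.euler
    have hH0 : aeval ![u, v] H = 0 := by rw [← eval_slice]; exact hroot
    simp only [map_add, map_mul, map_natCast, aeval_X, hH0, mul_zero, Matrix.cons_val_zero,
      Matrix.cons_val_one] at hEuler
    have h1 : aeval ![u, v] (pderiv 1 H) ≠ 0 := by
      intro h1
      rw [h1, mul_zero, mul_zero, add_zero] at hEuler
      have hsδ : ((s * δ : ℕ) : MvPolynomial (Fin n) k) ≠ 0 := Nat.cast_ne_zero.2 (by positivity)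
      exact mul_ne_zero hsδ (mul_ne_zero hu h0) hEuler
    have hD : 2 * δ ≤ D := by
      rw [hr] at hmul
      nlinarith
    exact ((h.pderiv 1 (D' := D - 2 * δ) (by simpa using Nat.sub_add_cancel hD)).aeval
      h₀ h₁).deg_eq h1

end Inequality

end SURed

/-! ### Elementary reductions -/

namespace SURed

open MvPolynomial

section Elementary

variable {k : Type*} [Field k]

theorem aeval_eq_self_of_mem_adjoin {y ψ : MvPolynomial (Fin 3) k}
    (hψ : ψ ∈ Algebra.adjoin k {X 0, X 1}) : aeval ![X 0, X 1, y] ψ = ψ := by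
  have hle : Algebra.adjoin k {X 0, X 1} ≤
      AlgHom.equalizer (aeval ![X 0, X 1, y]) (AlgHom.id k (MvPolynomial (Fin 3) k)) := by
    refine Algebra.adjoin_le ?_
    rintro _ (rfl | rfl) <;> simp
  exact hle hψ

/-- The automorphism `x₃ ↦ x₃ + ψ` for a polynomial `ψ` in the first two variables. -/
noncomputable def elementaryAut (ψ : MvPolynomial (Fin 3) k)
    (hψ : ψ ∈ Algebra.adjoin k {X 0, X 1}) : Aut3 k :=
  AlgEquiv.ofAlgHom (aeval ![X 0, X 1, X 2 + ψ]) (aeval ![X 0, X 1, X 2 - ψ])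
    (by
      ext i : 1
      fin_cases i <;> simp [aeval_eq_self_of_mem_adjoin hψ, -aeval_eq_bind₁])
    (by
      ext i : 1
      fin_cases i <;> simp [aeval_eq_self_of_mem_adjoin hψ, -aeval_eq_bind₁])

theorem admitsElementaryReduction_of_deg_lt (F : Aut3 k) {φ : MvPolynomial (Fin 3) k}
    (hφ : φ ∈ Algebra.adjoin k {triple F 0, triple F 1})
    (hlt : deg (triple F 2 + φ) < deg (triple F 2)) : AdmitsElementaryReduction F := by
  have hψ : F.symm φ ∈ Algebra.adjoin k {X 0, X 1} := by
    have hmem : F.symm φ ∈ (Algebra.adjoin k {triple F 0, triple F 1}).map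
        (F.symm : MvPolynomial (Fin 3) k →ₐ[k] MvPolynomial (Fin 3) k) := ⟨φ, hφ, rfl⟩
    rw [AlgHom.map_adjoin] at hmem
    simpa [triple, Set.image_pair] using hmem
  have hE : ∀ i, elementaryAut (F.symm φ) hψ (X i) = ![X 0, X 1, X 2 + F.symm φ] i :=
    fun i => aeval_X _ i
  refine ⟨elementaryAut (F.symm φ) hψ, ⟨2, ⟨F.symm φ, ?_, hE 2⟩, fun i hi => ?_⟩, ?_⟩
  · refine Algebra.adjoin_mono ?_ hψ
    rintro _ (rfl | rfl)
    · exact ⟨0, by decide, rfl⟩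
    · exact ⟨1, by decide, rfl⟩
  · rw [hE]
    fin_cases i
    · rfl
    · rfl
    · exact absurd rfl hi
  · have h0 : triple ((elementaryAut (F.symm φ) hψ).trans F) 0 = triple F 0 := by
      simp [triple, hE]
    have h1 : triple ((elementaryAut (F.symm φ) hψ).trans F) 1 = triple F 1 := by
      simp [triple, hE]
    have h2 : triple ((elementaryAut (F.symm φ) hψ).trans F) 2 = triple F 2 + φ := by
      simp [triple, hE]
    have hne : ∀ i, deg (triple F i) ≠ ⊥ := fun i => by
      rw [Ne, deg_eq_bot]
      simp [triple]
    rw [autDeg, autDeg, Fin.sum_univ_three, Fin.sum_univ_three, h0, h1, h2]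
    exact WithBot.add_lt_add_left (by simp [hne]) hlt

end Elementary

/-! ### The numerical consequences of the Shestakov–Umirbaev condition -/

section Condition

variable {k : Type*} [Field k]

theorem formDeg_dwedge_comm {n : ℕ} (f g : MvPolynomial (Fin n) k) :
    formDeg (dwedge f g) = formDeg (dwedge g f) := by
  have h : dwedge f g = (C (-1) : MvPolynomial (Fin n) k) • dwedge g f := by
    rw [dwedge_swap, map_neg, map_one]
    exact (neg_one_smul (MvPolynomial (Fin n) k) (dwedge g f)).symm
  rw [h, formDeg_smul, deg_C _ (neg_ne_zero.2 one_ne_zero), zero_add]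

theorem two_nsmul_coe (d : ℕ) : 2 • (d : WithBot ℕ) = ((2 * d : ℕ) : WithBot ℕ) := by
  rw [two_nsmul, two_mul, Nat.cast_add]

theorem exists_deg_triple_eq (F : Aut3 k) (i : Fin 3) :
    ∃ d : ℕ, 0 < d ∧ deg (triple F i) = (d : WithBot ℕ) := by
  have hne : triple F i ≠ 0 := by simp [triple]
  refine ⟨_, Nat.pos_of_ne_zero fun h => ?_, deg_eq_totalDegree hne⟩
  rw [totalDegree_eq_zero_iff_eq_C] at h
  have h1 : X i = (C (coeff 0 (triple F i)) : MvPolynomial (Fin 3) k) := by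
    apply F.injective
    rw [← algebraMap_eq, AlgEquiv.commutes, algebraMap_eq]
    exact h
  have h2 := congrArg totalDegree h1
  rw [totalDegree_X, totalDegree_C] at h2
  exact one_ne_zero h2

theorem not_algebraicIndependent_of_linDep {n s : ℕ} {u v : MvPolynomial (Fin n) k}
    (h : LinDep (u ^ 2) (v ^ s)) (hs : s ≠ 0) : ¬ AlgebraicIndependent k ![v, u] := by
  rw [LinDep, LinearIndependent.pair_iff] at h
  push Not at h
  obtain ⟨x, y, hxy, hne⟩ := h
  intro hind
  have hP : aeval ![v, u] (C x * X 1 ^ 2 + C y * X 0 ^ s : MvPolynomial (Fin 2) k) = 0 := by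
    rw [← hxy]
    simp [Algebra.smul_def, -aeval_eq_bind₁]
  have hP0 := hind.eq_zero_of_aeval_eq_zero _ hP
  have hx := congrArg (eval ![(0 : k), 1]) hP0
  have hy := congrArg (eval ![(1 : k), 0]) hP0
  simp [hs] at hx hy
  exact hne hx hy

/-- If `w` and `v` are homogeneous of degrees `sδ` and `2δ` with `s` odd, then `w` spans the
homogeneous elements of degree `sδ` of `k[w, v]`. -/
theorem exists_eq_smul_of_mem_adjoin {n s δ : ℕ} (hs : Odd s) (hδ : 0 < δ)
    {w v p : MvPolynomial (Fin n) k} (hw : w.IsHomogeneous (s * δ)) (hv : v.IsHomogeneous (2 * δ))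
    (hp : p.IsHomogeneous (s * δ)) (hmem : p ∈ Algebra.adjoin k {w, v}) : ∃ x : k, p = x • w := by
  have hrange : Set.range ![w, v] = {w, v} := by
    simp [Matrix.range_cons, Matrix.range_empty, Set.pair_comm]
  rw [← hrange, Algebra.adjoin_range_eq_range_aeval] at hmem
  obtain ⟨P, hP⟩ := hmem
  have hP' : aeval ![w, v] P = p := hP
  rw [aeval_eq_sum] at hP'
  have hc := homogeneousComponent_eq_self hp
  rw [← hP', map_sum] at hc
  rw [← hP', ← hc]
  refine ⟨∑ m ∈ P.support, if m 0 = 1 ∧ m 1 = 0 then coeff m P else 0, ?_⟩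
  rw [Finset.sum_smul]
  refine Finset.sum_congr rfl fun m _ => ?_
  have hm : (w ^ m 0 * v ^ m 1).IsHomogeneous (s * δ * m 0 + 2 * δ * m 1) :=
    (hw.pow _).mul (hv.pow _)
  rw [map_smul, homogeneousComponent_of_mem hm]
  have hs0 : 0 < s := hs.pos
  by_cases h : m 0 = 1 ∧ m 1 = 0
  · simp [h.1, h.2]
  · rw [if_neg h, if_neg, smul_zero, zero_smul]
    intro heq
    have h1 : s = s * m 0 + 2 * m 1 := by
      refine Nat.eq_of_mul_eq_mul_right hδ ?_
      linarith
    have h2 : m 0 < 2 := by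
      by_contra hge
      have := Nat.mul_le_mul_left s (not_lt.1 hge)
      omega
    interval_cases h3 : m 0
    · obtain ⟨j, hj⟩ := hs
      omega
    · omega

theorem degrees_of_linDep {n d₀ d₁ s : ℕ} {g₀ g₁ : MvPolynomial (Fin n) k} (hs : Odd s)
    (h₀ : deg g₀ = (d₀ : WithBot ℕ)) (h₁ : deg g₁ = (d₁ : WithBot ℕ))
    (h : LinDep (lead g₀ ^ 2) (lead g₁ ^ s)) : ∃ δ, d₀ = s * δ ∧ d₁ = 2 * δ := by
  have hu := pow_ne_zero 2 (lead_ne_zero (ne_zero_of_deg_eq h₀))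
  have hv := pow_ne_zero s (lead_ne_zero (ne_zero_of_deg_eq h₁))
  have hu' := (HasTop.of_deg_eq h₀).1.pow 2
  have hv' := (HasTop.of_deg_eq h₁).1.pow s
  have heq : d₀ * 2 = d₁ * s := by
    by_contra hne
    rw [LinDep, LinearIndependent.pair_iff] at h
    refine h fun x y hxy => ?_
    have hx := congrArg (homogeneousComponent (d₀ * 2)) hxy
    have hy := congrArg (homogeneousComponent (d₁ * s)) hxy
    simp only [map_add, map_smul, homogeneousComponent_of_mem hu',
      homogeneousComponent_of_mem hv', if_true, if_neg hne, if_neg (Ne.symm hne), smul_zero,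
      add_zero, zero_add, map_zero] at hx hy
    exact ⟨(smul_eq_zero.1 hx).resolve_right hu, (smul_eq_zero.1 hy).resolve_right hv⟩
  obtain ⟨δ, hδ⟩ : Even d₁ := by
    have : Even (d₁ * s) := heq ▸ ⟨d₀, by ring⟩
    exact (Nat.even_mul.1 this).resolve_right (Nat.not_even_iff_odd.2 hs)
  refine ⟨δ, ?_, by omega⟩
  subst hδ
  have : d₀ * 2 = (s * δ) * 2 := by rw [heq]; ring
  omega

/-- The Shestakov–Umirbaev condition with the degrees written out: `deg g₁ = sδ`, `deg g₂ = 2δ`,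
`deg f₃ = d`, `deg g₃ = d'` and `deg (dg₁ ∧ dg₂) = N`. -/
structure SUData (f g : Fin 3 → MvPolynomial (Fin 3) k) (s δ d d' N : ℕ) (a b c : k) : Prop where
  g_zero : g 0 = f 0 + a • (f 2) ^ 2 + c • f 2
  g_one : g 1 = f 1 + b • f 2
  sub_mem : g 2 - f 2 ∈ Algebra.adjoin k {g 0, g 1}
  deg_f_zero_le : deg (f 0) ≤ deg (g 0)
  deg_f_one : deg (f 1) = ((2 * δ : ℕ) : WithBot ℕ)
  odd_s : Odd s
  three_le_s : 3 ≤ s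
  delta_pos : 0 < δ
  deg_g_zero : deg (g 0) = ((s * δ : ℕ) : WithBot ℕ)
  deg_g_one : deg (g 1) = ((2 * δ : ℕ) : WithBot ℕ)
  deg_f_two : deg (f 2) = (d : WithBot ℕ)
  deg_g_two : deg (g 2) = (d' : WithBot ℕ)
  formDeg_eq : formDeg (dwedge (g 1) (g 0)) = (N : WithBot ℕ)
  N_pos : 0 < N
  lt_d : d' < d
  d_le : d ≤ s * δ
  d'_add_lt : d' + 2 * δ < s * δ + N
  notMem : lead (f 2) ∉ Algebra.adjoin k {lead (g 0), lead (g 1)}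
  not_algebraicIndependent : ¬ AlgebraicIndependent k ![lead (g 1), lead (g 0)]

theorem SUCondition.exists_suData {F G : Aut3 k} (h : SUCondition (triple F) (triple G)) :
    ∃ s δ d d' N a b c, SUData (triple F) (triple G) s δ d d' N a b c := by
  obtain ⟨⟨⟨a, b, c, h0, h1⟩, hmem⟩, ⟨hf0, hf1⟩, ⟨s, hs, hs3, hdep⟩, ⟨h40, h41⟩, h5, h6⟩ := h
  obtain ⟨d₀, hd₀, hg₀⟩ := exists_deg_triple_eq G 0
  obtain ⟨d₁, hd₁, hg₁⟩ := exists_deg_triple_eq G 1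
  obtain ⟨d', -, hg₂⟩ := exists_deg_triple_eq G 2
  obtain ⟨d, -, hf₂⟩ := exists_deg_triple_eq F 2
  obtain ⟨δ, rfl, rfl⟩ := degrees_of_linDep hs hg₀ hg₁ hdep
  rw [formDeg_dwedge_comm] at h6
  have hbot : formDeg (dwedge (triple G 1) (triple G 0)) ≠ ⊥ := by
    intro hb
    rw [hb, WithBot.add_bot] at h6
    exact not_lt_bot h6
  obtain ⟨N, hN⟩ := WithBot.ne_bot_iff_exists.1 hbot
  have hN' : formDeg (dwedge (triple G 1) (triple G 0)) = (N : WithBot ℕ) := hN.symm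
  refine ⟨s, δ, d, d', N, a, b, c, h0, h1, hmem, hf0, hf1.trans hg₁, hs, hs3, by omega, hg₀, hg₁,
    hf₂, hg₂, hN', ?_, ?_, ?_, ?_, h41, not_algebraicIndependent_of_linDep hdep hs.pos.ne'⟩
  · have := le_formDeg hbot
    rw [hN'] at this
    have h2 : 2 ≤ N := by exact_mod_cast this
    omega
  · rw [hf₂, hg₂] at h5
    exact_mod_cast h5
  · rw [hf₂, hg₀] at h40
    exact_mod_cast h40
  · rw [hg₂, hg₁, hg₀, hN'] at h6
    exact_mod_cast h6

namespace SUData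

variable {f g : Fin 3 → MvPolynomial (Fin 3) k} {s δ d d' N : ℕ} {a b c : k}

theorem hasTop_g_zero (h : SUData f g s δ d d' N a b c) : HasTop (s * δ) (g 0) (lead (g 0)) :=
  .of_deg_eq h.deg_g_zero

theorem hasTop_g_one (h : SUData f g s δ d d' N a b c) : HasTop (2 * δ) (g 1) (lead (g 1)) :=
  .of_deg_eq h.deg_g_one

theorem hasTop_f_two (h : SUData f g s δ d d' N a b c) : HasTop d (f 2) (lead (f 2)) :=
  .of_deg_eq h.deg_f_two

theorem lead_g_zero_ne (h : SUData f g s δ d d' N a b c) : lead (g 0) ≠ 0 :=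
  lead_ne_zero (ne_zero_of_deg_eq h.deg_g_zero)

theorem lead_g_one_ne (h : SUData f g s δ d d' N a b c) : lead (g 1) ≠ 0 :=
  lead_ne_zero (ne_zero_of_deg_eq h.deg_g_one)

theorem lead_f_two_ne (h : SUData f g s δ d d' N a b c) : lead (f 2) ≠ 0 :=
  lead_ne_zero (ne_zero_of_deg_eq h.deg_f_two)

theorem lead_f_two_ne_smul_zero (h : SUData f g s δ d d' N a b c) (x : k) :
    lead (f 2) ≠ x • lead (g 0) := fun h0 =>
  h.notMem (h0 ▸ Subalgebra.smul_mem _ (Algebra.subset_adjoin (by simp)) x)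

/-- No nontrivial linear combination of the leading forms of `g₁` and `f₃` vanishes. -/
theorem eq_zero_of_smul_zero_add (h : SUData f g s δ d d' N a b c) {x y : k}
    (hxy : x • lead (g 0) + y • lead (f 2) = 0) : x = 0 ∧ y = 0 := by
  have hy : y = 0 := by
    by_contra hy
    refine h.lead_f_two_ne_smul_zero (-(y⁻¹ * x)) ?_
    rw [← inv_smul_smul₀ hy (lead (f 2)), eq_neg_of_add_eq_zero_right hxy, smul_neg, smul_smul,
      neg_smul]
  subst hy
  rw [zero_smul, add_zero] at hxy
  exact ⟨(smul_eq_zero.1 hxy).resolve_right h.lead_g_zero_ne, rfl⟩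

/-- No nontrivial linear combination of the leading forms of `g₂` and `f₃` vanishes. -/
theorem eq_zero_of_smul_one_add (h : SUData f g s δ d d' N a b c) {x y : k}
    (hxy : x • lead (g 1) + y • lead (f 2) = 0) : x = 0 ∧ y = 0 := by
  have hy : y = 0 := by
    by_contra hy
    refine h.notMem ?_
    rw [← inv_smul_smul₀ hy (lead (f 2)), eq_neg_of_add_eq_zero_right hxy]
    exact Subalgebra.smul_mem _ (Subalgebra.neg_mem _
      (Subalgebra.smul_mem _ (Algebra.subset_adjoin (by simp)) _)) _
  subst hy
  rw [zero_smul, add_zero] at hxy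
  exact ⟨(smul_eq_zero.1 hxy).resolve_right h.lead_g_one_ne, rfl⟩

theorem hasTop_sub (h : SUData f g s δ d d' N a b c) : HasTop d (g 2 - f 2) (0 - lead (f 2)) := by
  refine (HasTop.of_deg_lt ?_).sub h.hasTop_f_two
  rw [h.deg_g_two]
  exact_mod_cast h.lt_d

theorem formDeg_lt (h : SUData f g s δ d d' N a b c) :
    formDeg (dwedge (g 1) (g 2)) <
      ((s * δ : ℕ) : WithBot ℕ) + formDeg (dwedge (g 1) (g 0)) := by
  refine (formDeg_dwedge_le _ _).trans_lt ?_
  rw [h.deg_g_one, h.deg_g_two, h.formDeg_eq]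
  have := h.d'_add_lt
  rw [add_comm d'] at this
  exact_mod_cast this

/-- The Shestakov–Umirbaev inequality for `g₃ - f₃ = Ψ(g₁, g₂)`, whose leading form is that of
`-f₃` and hence does not lie in the algebra generated by the leading forms of `g₁, g₂`. -/
theorem exists_inequality [CharZero k] (h : SUData f g s δ d d' N a b c) :
    ∃ (Ψ : MvPolynomial (Fin 2) k) (D r : ℕ), aeval ![g 0, g 1] Ψ = g 2 - f 2 ∧ 0 < r ∧
      r * (s * δ) + r * N ≤ d + r * (2 * δ) ∧ 2 * r * (s * δ) ≤ D ∧
      (r = 1 → deg (aeval ![g 0, g 1] (pderiv 1 Ψ)) = ((D - 2 * δ : ℕ) : WithBot ℕ)) := by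
  have hmem := h.sub_mem
  have hrange : Set.range ![g 0, g 1] = {g 0, g 1} := by
    simp [Matrix.range_cons, Matrix.range_empty, Set.pair_comm]
  rw [← hrange, Algebra.adjoin_range_eq_range_aeval] at hmem
  obtain ⟨Ψ, hΨ⟩ := hmem
  have hΨ' : aeval ![g 0, g 1] Ψ = g 2 - f 2 := hΨ
  have hne : (0 : MvPolynomial (Fin 3) k) - lead (f 2) ≠ 0 := by simpa using h.lead_f_two_ne
  have hΨ0 : Ψ ≠ 0 := by
    rintro rfl
    have := h.hasTop_sub
    rw [← hΨ', map_zero] at this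
    exact hne (this.unique .zero)
  obtain ⟨D, r, hD, hineq, hr0, hr1⟩ := exists_shestakov_umirbaev h.odd_s h.delta_pos
    h.hasTop_g_zero h.hasTop_g_one h.lead_g_zero_ne h.lead_g_one_ne h.formDeg_eq hΨ0
  refine ⟨Ψ, D, r, hΨ', Nat.pos_of_ne_zero fun hr => ?_, ?_, hD, hr1⟩
  · have := hr0 hr
    rw [hΨ', h.hasTop_sub.lead_eq hne] at this
    exact h.notMem (by simpa using Subalgebra.neg_mem _ this)
  · rw [hΨ', h.hasTop_sub.deg_eq hne] at hineq
    have hineq' : D + r * N ≤ d + r * (s * δ + 2 * δ) := by exact_mod_cast hineq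
    linarith

/-- The inequality `deg f₃ ≥ (s - 2)δ + N`, obtained from the previous one by dividing by the
multiplicity `r`. -/
theorem add_le [CharZero k] (h : SUData f g s δ d d' N a b c) : s * δ + N ≤ d + 2 * δ := by
  obtain ⟨Ψ, D, r, -, hr, hineq, -⟩ := h.exists_inequality
  obtain ⟨t, ht⟩ : ∃ t, s = t + 2 := ⟨s - 2, by have := h.three_le_s; omega⟩
  have h1 : r * (t * δ + N) ≤ d := by
    subst ht
    linarith
  have h2 : t * δ + N ≤ d := (Nat.le_mul_of_pos_left _ hr).trans h1
  subst ht
  linarith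

/-- If `deg f₃ ≤ deg g₂`, then the odd number `s` is `3`. -/
theorem s_eq_three [CharZero k] (h : SUData f g s δ d d' N a b c) (hd : d ≤ 2 * δ) : s = 3 := by
  have h1 := h.add_le
  have h2 := h.three_le_s
  have h3 := h.N_pos
  by_contra hne
  have h4 : 4 * δ ≤ s * δ := Nat.mul_le_mul_right _ (by omega)
  omega

/-- If `2 deg f₃ > deg g₁`, then a term `a f₃²` would dominate `g₁ - f₁`. -/
theorem a_eq_zero (h : SUData f g s δ d d' N a b c) (hd : s * δ < 2 * d) : a = 0 := by
  have hd0 : 0 < d := by omega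
  have h1 : HasTop (2 * d) (a • f 2 ^ 2 + c • f 2) (a • lead (f 2) ^ 2 + 0) := by
    refine ((h.hasTop_f_two.pow 2).smul a).add (.of_deg_lt ?_)
    refine (deg_smul_le _ _).trans_lt ?_
    rw [h.deg_f_two]
    exact_mod_cast (by omega : d < 2 * d)
  have h2 : HasTop (2 * d) (a • f 2 ^ 2 + c • f 2) 0 := by
    refine .of_deg_lt ?_
    have heq : a • f 2 ^ 2 + c • f 2 = g 0 - f 0 := by rw [h.g_zero]; ring
    rw [heq]
    refine (deg_sub_le _ _).trans_lt ((max_le le_rfl h.deg_f_zero_le).trans_lt ?_)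
    rw [h.deg_g_zero]
    exact_mod_cast hd
  have h3 := h1.unique h2
  rw [add_zero] at h3
  exact (smul_eq_zero.1 h3).resolve_right (pow_ne_zero _ h.lead_f_two_ne)

theorem b_eq_zero (h : SUData f g s δ d d' N a b c) (hd : 2 * δ < d) : b = 0 := by
  have h1 := h.hasTop_f_two.smul b
  have h2 : HasTop d (b • f 2) 0 := by
    refine .of_deg_lt ?_
    have heq : b • f 2 = g 1 - f 1 := by rw [h.g_one]; ring
    rw [heq]
    refine (deg_sub_le _ _).trans_lt ?_
    rw [h.deg_g_one, h.deg_f_one, max_self]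
    exact_mod_cast hd
  exact (smul_eq_zero.1 (h1.unique h2)).resolve_right h.lead_f_two_ne

/-! ### The three types -/

/-- The case `deg f₃ > 2δ`. When `deg f₃ = sδ`, subtracting a multiple of `f₃` changes the leading
form of `g₁`, but no other monomial in the leading forms has degree `sδ`, as `s` is odd. -/
theorem typeI [CharZero k] (h : SUData f g s δ d d' N a b c) (hd : 2 * δ < d)
    (hne : (f 0, f 1) ≠ (g 0, g 1)) : TypeI (f ∘ Equiv.swap 0 1) := by
  have hadd := h.add_le
  have hN := h.N_pos
  have ha : a = 0 := h.a_eq_zero (by omega)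
  have hb : b = 0 := h.b_eq_zero hd
  have hf1 : f 1 = g 1 := by rw [h.g_one, hb, zero_smul, add_zero]
  have hf0 : f 0 = g 0 - c • f 2 := by rw [h.g_zero, ha, zero_smul, add_zero, add_sub_cancel_right]
  have hc : c ≠ 0 := by
    rintro rfl
    exact hne (by rw [hf1, hf0, zero_smul, sub_zero])
  have key : deg (f 0) = ((s * δ : ℕ) : WithBot ℕ) ∧
      lead (f 2) ∉ Algebra.adjoin k {lead (f 1), lead (f 0)} := by
    rcases h.d_le.lt_or_eq with hlt | heq
    · have htop : HasTop (s * δ) (f 0) (lead (g 0)) := by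
        have h1 : HasTop (s * δ) (f 2) 0 := .of_deg_lt (by
          rw [h.deg_f_two]
          exact_mod_cast hlt)
        rw [hf0]
        simpa using h.hasTop_g_zero.sub (h1.smul c)
      refine ⟨htop.deg_eq h.lead_g_zero_ne, ?_⟩
      rw [htop.lead_eq h.lead_g_zero_ne, hf1, Set.pair_comm]
      exact h.notMem
    · have htop : HasTop (s * δ) (f 0) (lead (g 0) - c • lead (f 2)) := by
        rw [hf0]
        exact h.hasTop_g_zero.sub ((heq ▸ h.hasTop_f_two).smul c)
      have h0 : lead (g 0) - c • lead (f 2) ≠ 0 := by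
        intro h0
        have := h.eq_zero_of_smul_zero_add (x := 1) (y := -c) (by
          rw [one_smul, neg_smul, ← sub_eq_add_neg, h0])
        exact one_ne_zero this.1
      refine ⟨htop.deg_eq h0, ?_⟩
      rw [htop.lead_eq h0, hf1, Set.pair_comm]
      intro hmem
      obtain ⟨x, hx⟩ := exists_eq_smul_of_mem_adjoin h.odd_s h.delta_pos htop.1
        h.hasTop_g_one.1 (heq ▸ h.hasTop_f_two.1) hmem
      have hlin := h.eq_zero_of_smul_zero_add (x := -x) (y := 1 + x * c) (by
        have : -x • lead (g 0) + (1 + x * c) • lead (f 2) =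
          lead (f 2) - x • (lead (g 0) - c • lead (f 2)) := by module
        rw [this, ← hx, sub_self])
      have hx0 : x = 0 := neg_eq_zero.1 hlin.1
      rw [hx0, zero_mul, add_zero] at hlin
      exact one_ne_zero hlin.2
  refine ⟨δ, s, h.delta_pos, h.odd_s, h.three_le_s, h.deg_f_one, key.1, ?_, ?_, key.2, -c,
    neg_ne_zero.2 hc, g 1, g 0, hf1.symm, ?_, h.deg_g_zero, h.not_algebraicIndependent,
    g 2 - f 2, by rw [Set.pair_comm]; exact h.sub_mem, g 2, ?_, ?_, h.formDeg_lt⟩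
  · show _ < deg (f 2)
    rw [h.deg_f_two]
    exact_mod_cast hd
  · show deg (f 2) ≤ _
    rw [h.deg_f_two]
    exact_mod_cast h.d_le
  · show g 0 = f 0 - -c • f 2
    rw [hf0, neg_smul, sub_neg_eq_add, sub_add_cancel]
  · show g 2 = f 2 + (g 2 - f 2)
    rw [add_sub_cancel]
  · show deg (g 2) < deg (f 2)
    rw [h.deg_g_two, h.deg_f_two]
    exact_mod_cast h.lt_d

/-- The case `3δ/2 < deg f₃ ≤ 2δ`. -/
theorem typeII [CharZero k] (h : SUData f g s δ d d' N a b c) (hd : d ≤ 2 * δ)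
    (hd3 : 3 * δ < 2 * d) (hne : (f 0, f 1) ≠ (g 0, g 1)) : TypeII (f ∘ Equiv.swap 0 1) := by
  have hs := h.s_eq_three hd
  subst hs
  have hδ := h.delta_pos
  have ha : a = 0 := h.a_eq_zero hd3
  have hf0 : f 0 = g 0 - c • f 2 := by rw [h.g_zero, ha, zero_smul, add_zero, add_sub_cancel_right]
  have hf1 : f 1 = g 1 - b • f 2 := by rw [h.g_one, add_sub_cancel_right]
  have hdeg : deg (f 0) = ((3 * δ : ℕ) : WithBot ℕ) := by
    have h1 : HasTop (3 * δ) (f 2) 0 := .of_deg_lt (by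
      rw [h.deg_f_two]
      exact_mod_cast (by omega : d < 3 * δ))
    have htop := h.hasTop_g_zero.sub (h1.smul c)
    rw [← hf0, smul_zero, sub_zero] at htop
    exact htop.deg_eq h.lead_g_zero_ne
  have hlin : ¬ LinDep (lead (f 1)) (lead (f 2)) := by
    rw [LinDep, not_not, LinearIndependent.pair_iff]
    intro x y hxy
    rcases hd.lt_or_eq with hlt | heq
    · have h1 : HasTop (2 * δ) (f 2) 0 := .of_deg_lt (by
        rw [h.deg_f_two]
        exact_mod_cast hlt)
      have htop := h.hasTop_g_one.sub (h1.smul b)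
      rw [← hf1, smul_zero, sub_zero] at htop
      rw [htop.lead_eq h.lead_g_one_ne] at hxy
      exact h.eq_zero_of_smul_one_add hxy
    · have htop := h.hasTop_g_one.sub ((heq ▸ h.hasTop_f_two).smul b)
      rw [← hf1] at htop
      rw [(HasTop.of_deg_eq h.deg_f_one).unique htop] at hxy
      have := h.eq_zero_of_smul_one_add (x := x) (y := y - x * b) (by
        rw [← hxy]
        module)
      obtain ⟨rfl, hy⟩ := this
      exact ⟨rfl, by simpa using hy⟩
  refine ⟨δ, hδ, h.deg_f_one, hdeg, ?_, ?_, hlin, -b, -c, ?_, g 1, g 0, ?_, ?_, h.deg_g_one,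
    h.deg_g_zero, h.not_algebraicIndependent, g 2 - f 2,
    by rw [Set.pair_comm]; exact h.sub_mem, g 2, ?_, ?_, h.formDeg_lt⟩
  · show _ < 2 • deg (f 2)
    rw [h.deg_f_two, two_nsmul_coe]
    exact_mod_cast hd3
  · show deg (f 2) ≤ _
    rw [h.deg_f_two]
    exact_mod_cast hd
  · intro h0
    simp only [Prod.mk.injEq, neg_eq_zero] at h0
    exact hne (by rw [hf0, hf1, h0.1, h0.2, zero_smul, sub_zero, sub_zero])
  · show g 1 = f 1 - -b • f 2
    rw [hf1, neg_smul, sub_neg_eq_add, sub_add_cancel]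
  · show g 0 = f 0 - -c • f 2
    rw [hf0, neg_smul, sub_neg_eq_add, sub_add_cancel]
  · show g 2 = f 2 + (g 2 - f 2)
    rw [add_sub_cancel]
  · show deg (g 2) < deg (f 2)
    rw [h.deg_g_two, h.deg_f_two]
    exact_mod_cast h.lt_d

/-- If `deg f₁ < deg g₁`, then the multiplicity in the Shestakov–Umirbaev inequality is `1`. This
bounds `dg₁ ∧ df₃ = df₁ ∧ df₃`, hence `deg f₁`, from below. -/
theorem five_mul_lt [CharZero k] (h : SUData f g 3 δ d d' N a b c) (hd : 2 * d = 3 * δ)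
    {e : ℕ} (he : deg (f 0) = (e : WithBot ℕ)) : 5 * δ < 2 * e := by
  obtain ⟨Ψ, D, r, hΨ, hr, hineq, hD, hr1⟩ := h.exists_inequality
  have hδ := h.delta_pos
  have hN := h.N_pos
  have hr' : r = 1 := by
    have h1 : r * (δ + N) ≤ d := by linarith
    have h2 : ¬ 2 ≤ r := fun h2 => by
      have := Nat.mul_le_mul_right (δ + N) h2
      omega
    omega
  subst hr'
  have hdeg := hr1 rfl
  have h1 : formDeg (dwedge (g 0) (g 2 - f 2)) = ((D - 2 * δ + N : ℕ) : WithBot ℕ) := by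
    rw [← hΨ, dwedge_aeval, Fin.sum_univ_two]
    simp only [Matrix.cons_val_zero, Matrix.cons_val_one]
    rw [dwedge_self, smul_zero, zero_add, formDeg_smul, hdeg, formDeg_dwedge_comm, h.formDeg_eq,
      Nat.cast_add]
  have h2 : formDeg (dwedge (g 0) (g 2)) < ((4 * δ + N : ℕ) : WithBot ℕ) := by
    refine (formDeg_dwedge_le _ _).trans_lt ?_
    rw [h.deg_g_zero, h.deg_g_two]
    have := h.d'_add_lt
    exact_mod_cast (by omega : 3 * δ + d' < 4 * δ + N)
  have h3 : formDeg (dwedge (g 0) (f 2)) ≤ ((d + e : ℕ) : WithBot ℕ) := by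
    have heq : dwedge (f 2) (g 0) = dwedge (f 2) (f 0) := by
      rw [h.g_zero, dwedge_add_right, dwedge_add_right, dwedge_smul_right, dwedge_smul_right,
        pow_two, dwedge_mul_right, dwedge_self]
      simp
    rw [formDeg_dwedge_comm, heq]
    refine (formDeg_dwedge_le _ _).trans ?_
    rw [h.deg_f_two, he, Nat.cast_add]
  have h4 : dwedge (g 0) (g 2 - f 2) = dwedge (g 0) (g 2) +
      (C (-1) : MvPolynomial (Fin 3) k) • dwedge (g 0) (f 2) := by
    rw [← dwedge_smul_right, ← dwedge_add_right, neg_one_smul, ← sub_eq_add_neg]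
  have h5 := formDeg_add_le (dwedge (g 0) (g 2))
    ((C (-1) : MvPolynomial (Fin 3) k) • dwedge (g 0) (f 2))
  rw [← h4, h1, formDeg_smul, deg_C _ (neg_ne_zero.2 one_ne_zero), zero_add] at h5
  rcases le_max_iff.1 h5 with h6 | h6
  · have : D - 2 * δ + N < 4 * δ + N := by exact_mod_cast h6.trans_lt h2
    omega
  · have : D - 2 * δ + N ≤ d + e := by exact_mod_cast h6.trans h3
    omega

/-- The case `deg f₃ ≤ 3δ/2`. -/
theorem typeIII [CharZero k] (h : SUData f g s δ d d' N a b c) (hd : 2 * d ≤ 3 * δ) {e : ℕ}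
    (he : deg (f 0) = (e : WithBot ℕ)) (hne : (f 0, f 1) ≠ (g 0, g 1)) :
    TypeIII (f ∘ Equiv.swap 0 1) := by
  have hs := h.s_eq_three (by omega)
  subst hs
  have hδ := h.delta_pos
  have hadd := h.add_le
  have hN := h.N_pos
  have hf0 : f 0 = g 0 - c • f 2 - a • f 2 ^ 2 := by rw [h.g_zero]; ring
  have hf1 : f 1 = g 1 - b • f 2 := by rw [h.g_one, add_sub_cancel_right]
  have he3 : e ≤ 3 * δ := by
    have := h.deg_f_zero_le
    rw [he, h.deg_g_zero] at this
    exact_mod_cast this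
  -- When `2 deg f₃ < 3δ`, the leading form of `g₁` cannot come from `f₃²`.
  have hcase : e = 3 * δ ∨ 2 * d = 3 * δ := by
    by_contra! hcon
    have h1 : HasTop (3 * δ) (f 2) 0 := .of_deg_lt (by
      rw [h.deg_f_two]
      exact_mod_cast (by omega : d < 3 * δ))
    have h2 : HasTop (3 * δ) (f 2 ^ 2) 0 := .of_deg_lt
      ((h.hasTop_f_two.pow 2).deg_le.trans_lt (by exact_mod_cast (by omega : 2 * d < 3 * δ)))
    have htop := (h.hasTop_g_zero.sub (h1.smul c)).sub (h2.smul a)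
    rw [← hf0, smul_zero, sub_zero, smul_zero, sub_zero] at htop
    have := htop.deg_eq h.lead_g_zero_ne
    rw [he] at this
    exact hcon.1 (by exact_mod_cast this)
  refine ⟨δ, hδ, h.deg_f_one, ?_, -a, -b, -c, ?_, g 1, g 0, ?_, ?_, h.deg_g_one,
    h.deg_g_zero, h.not_algebraicIndependent, 1, one_ne_zero, g 2 - f 2,
    by rw [Set.pair_comm]; exact h.sub_mem, ?_, g 2, ?_, ?_, h.formDeg_lt, ?_⟩
  · show (deg (f 0) = _ ∧ _ < deg (f 2) ∧ 2 • deg (f 2) ≤ _) ∨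
      (_ < 2 • deg (f 0) ∧ deg (f 0) ≤ _ ∧ 2 • deg (f 2) = _)
    rw [he, h.deg_f_two, two_nsmul_coe, two_nsmul_coe]
    rcases hcase with rfl | h2d
    · exact Or.inl ⟨rfl, by exact_mod_cast (by omega : δ < d), by exact_mod_cast hd⟩
    · exact Or.inr ⟨by exact_mod_cast h.five_mul_lt h2d he, by exact_mod_cast he3,
        by exact_mod_cast h2d⟩
  · intro h0
    simp only [Prod.mk.injEq, neg_eq_zero] at h0
    exact hne (by rw [hf0, hf1, h0.1, h0.2.1, h0.2.2]; simp)
  · show g 1 = f 1 - -b • f 2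
    rw [hf1, neg_smul, sub_neg_eq_add, sub_add_cancel]
  · show g 0 = f 0 - -c • f 2 - -a • f 2 ^ 2
    rw [hf0]
    module
  · rintro ⟨x, hx⟩
    have h1 := h.hasTop_sub.deg_eq (by simpa using h.lead_f_two_ne)
    have h2 : deg (C x : MvPolynomial (Fin 3) k) ≤ ((0 : ℕ) : WithBot ℕ) :=
      deg_le_coe_iff.2 (totalDegree_C x).le
    rw [hx, h1] at h2
    have : d ≤ 0 := by exact_mod_cast h2
    omega
  · show g 2 = (1 : k) • f 2 + (g 2 - f 2)
    rw [one_smul, add_sub_cancel]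
  · rw [h.deg_g_two, two_nsmul_coe]
    have := h.lt_d
    exact_mod_cast (by omega : 2 * d' ≤ 3 * δ)
  · rw [h.deg_g_two, h.formDeg_eq]
    have := h.d'_add_lt
    exact_mod_cast (by omega : d' < δ + N)

end SUData

end Condition

end SURed

theorem proposition7p2 {k : Type*} [Field k] [CharZero k] (F G : SURed.Aut3 k)
    (h : SURed.SUCondition (SURed.triple F) (SURed.triple G)) :
    ((SURed.triple F 0, SURed.triple F 1) = (SURed.triple G 0, SURed.triple G 1) →
      SURed.AdmitsElementaryReduction F) ∧
    ((SURed.triple F 0, SURed.triple F 1) ≠ (SURed.triple G 0, SURed.triple G 1) →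
      SURed.AdmitsTypeI F ∨ SURed.AdmitsTypeII F ∨ SURed.AdmitsTypeIII F) := by
  refine ⟨fun heq => ?_, fun hne => ?_⟩
  · have hmem := h.su1.2
    obtain ⟨h0, h1⟩ := Prod.mk.inj heq
    rw [← h0, ← h1] at hmem
    refine SURed.admitsElementaryReduction_of_deg_lt F hmem ?_
    rw [add_sub_cancel]
    exact h.su5
  · obtain ⟨s, δ, d, d', N, a, b, c, hd⟩ := h.exists_suData
    obtain ⟨e, -, he⟩ := SURed.exists_deg_triple_eq F 0
    rcases lt_or_ge (2 * δ) d with h1 | h1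
    · exact Or.inl ⟨Equiv.swap 0 1, hd.typeI h1 hne⟩
    rcases lt_or_ge (3 * δ) (2 * d) with h2 | h2
    · exact Or.inr (Or.inl ⟨Equiv.swap 0 1, hd.typeII h1 h2 hne⟩)
    · exact Or.inr (Or.inr ⟨Equiv.swap 0 1, hd.typeIII h2 he hne⟩)
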